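/- For a finite-dimensional real Lie algebra $L$ let $\mu(L)$ be the least $n$ such that $L$ has a faithful representation $L\to\mathfrak{gl}(n,\mathbb R)$. Let $e_1,\dots,e_8$ be a basis of $\mathbb R^8$. In the algebras below $e_1,e_2,e_3$ span a Levi factor and $e_4,\dots,e_8$ span the radical; brackets of basis vectors not determined by the data (and skew-symmetry) are zero. The Levi factor is $\mathfrak{so}(3)$: $[e_1,e_2]=e_3$, $[e_2,e_3]=e_1$, $[e_3,e_1]=e_2$, or $\mathfrak{sl}(2,\mathbb R)$: $[e_1,e_2]=2e_2$, $[e_1,e_3]=-2e_3$, $[e_2,e_3]=e_1$. It acts on the radical through the following modules, and trivially on the remaining basis vectors: * $R_3$ for $\mathfrak{so}(3)$ on $e_4,e_5,e_6$: $[e_1,e_5]=e_6$, $[e_1,e_6]=-e_5$, $[e_2,e_6]=e_4$, $[e_2,e_4]=-e_6$, $[e_3,e_4]=e_5$, $[e_3,e_5]=-e_4$. * $R_4$ for $\mathfrak{so}(3)$ on $e_4,\dots,e_7$ (irreducible): $2[e_1,\cdot]$ maps $(e_4,e_5,e_6,e_7)$ to $(e_7,e_6,-e_5,-e_4)$, $2[e_2,\cdot]$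 maps it to $(e_5,-e_4,e_7,-e_6)$, and $2[e_3,\cdot]$ maps it to $(e_6,-e_7,-e_4,e_5)$. * $D_{1/2}$ for $\mathfrak{sl}(2,\mathbb R)$ on $u,v$: $[e_1,u]=u$, $[e_1,v]=-v$, $[e_2,v]=u$, $[e_3,u]=v$. * $D_1$ for $\mathfrak{sl}(2,\mathbb R)$ on $e_4,e_5,e_6$: $[e_1,e_4]=2e_4$, $[e_1,e_6]=-2e_6$, $[e_2,e_5]=2e_4$, $[e_2,e_6]=e_5$, $[e_3,e_4]=e_5$, $[e_3,e_5]=2e_6$. * $D_{3/2}$ for $\mathfrak{sl}(2,\mathbb R)$ on $e_4,\dots,e_7$: $[e_1,e_4]=3e_4$, $[e_1,e_5]=e_5$, $[e_1,e_6]=-e_6$, $[e_1,e_7]=-3e_7$, $[e_2,e_5]=3e_4$, $[e_2,e_6]=2e_5$, $[e_2,e_7]=e_6$, $[e_3,e_4]=e_5$, $[e_3,e_5]=2e_6$, $[e_3,e_6]=3e_7$. Consider the following algebras, with the brackets of the radical as indicated ($p,q\in\mathbb R$). With Levi factor $\mathfrak{so}(3)$: * $L_{8.1}$ ($p\ne0$),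 module $R_3$: $[e_8,e_i]=e_i$ for $i=4,5,6$, $[e_8,e_7]=pe_7$. * $L_{8.3}$, module $R_4$: $[e_8,e_i]=e_i$ for $i=4,5,6,7$. * $L_{8.4}$ (all $p$), module $R_4$: $[e_8,e_4]=pe_4-e_6$, $[e_8,e_6]=e_4+pe_6$, $[e_8,e_5]=pe_5-e_7$, $[e_8,e_7]=e_5+pe_7$. With Levi factor $\mathfrak{sl}(2,\mathbb R)$ and module $D_{1/2}$ on $e_4,e_5$, where always $[e_8,e_4]=e_4$ and $[e_8,e_5]=e_5$: * $L_{8.7}$ ($pq\ne0$): $[e_8,e_6]=pe_6$, $[e_8,e_7]=qe_7$. * $L_{8.8}$ (all $p$): $[e_8,e_6]=pe_6$, $[e_8,e_7]=e_6+pe_7$. * $L_{8.9}$ (all $p$, $q\ne0$): $[e_8,e_6]=pe_6-qe_7$, $[e_8,e_7]=qe_6+pe_7$. * $L_{8.10}$ ($p\ne0$): $[e_4,e_5]=e_6$, $[e_8,e_6]=2e_6$, $[e_8,e_7]=pe_7$. * $L_{8.11}$: $[e_4,e_5]=e_6$, $[e_8,e_6]=2e_6$, $[e_8,e_7]=e_6+2e_7$.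 With Levi factor $\mathfrak{sl}(2,\mathbb R)$ and another module: * $L_{8.12}$ ($p\ne0,1$), module $D_1$: $[e_8,e_i]=e_i$ for $i=4,5,6$, $[e_8,e_7]=pe_7$. * $L_{8.20}$, module $D_{3/2}$: $[e_8,e_i]=e_i$ for $i=4,5,6,7$. * $L_{8.22}$, modules $D_1$ on $e_4,e_5,e_6$ and $D_{1/2}$ on $e_7,e_8$; the radical is abelian. Then $\mu(L)=5$ for each of these algebras $L$, for all indicated values of the parameters. -/

import Mathlib

attribute [local instance] LieRing.ofAssociativeRing

/-- The invariant `μ(L)` of a real Lie algebra: the least `n` for which `L` has a faithful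
representation by real `n × n` matrices, i.e. an injective Lie algebra homomorphism into
`gl(n, ℝ)` with the commutator bracket. -/
noncomputable def mu (L : Type*) [LieRing L] [LieAlgebra ℝ L] : ℕ :=
  sInf {n : ℕ | ∃ φ : L →ₗ⁅ℝ⁆ Matrix (Fin n) (Fin n) ℝ, Function.Injective φ}

namespace Levi8

/-- The standard basis `e₁, …, e₈` of `ℝ⁸`, numbered from zero: `e i` is `e_{i+1}`. -/
def e (i : Fin 8) : Fin 8 → ℝ := Pi.single i 1

/-- A list of brackets of basis vectors: an entry `(i, j, v)` says `[e i, e j] = v`. No unordered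
pair `{i, j}` occurs twice in the tables below, and pairs that do not occur commute. -/
abbrev Table := List (Fin 8 × Fin 8 × (Fin 8 → ℝ))

/-- The bilinear skew-symmetric extension of a table of brackets to `ℝ⁸`. -/
def Table.bracket (T : Table) (x y : Fin 8 → ℝ) : Fin 8 → ℝ :=
  (T.map fun t => (x t.1 * y t.2.1 - x t.2.1 * y t.1) • t.2.2).sum

/-- A table of brackets that satisfies the Jacobi identity. -/
structure LieTable where
  table : Table
  jacobi : ∀ x y z : Fin 8 → ℝ, table.bracket x (table.bracket y z) =
    table.bracket (table.bracket x y) z + table.bracket y (table.bracket x z)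

/-- The eight-dimensional real Lie algebra with a given table of brackets. -/
def LieTable.Alg (_S : LieTable) : Type := Fin 8 → ℝ

instance (S : LieTable) : AddCommGroup S.Alg := inferInstanceAs (AddCommGroup (Fin 8 → ℝ))

instance (S : LieTable) : Module ℝ S.Alg := inferInstanceAs (Module ℝ (Fin 8 → ℝ))

theorem Table.bracket_add_left (T : Table) (x x' y : Fin 8 → ℝ) :
    T.bracket (x + x') y = T.bracket x y + T.bracket x' y := by
  simp only [Table.bracket, ← List.sum_map_add]
  congr 1
  refine List.map_congr_left fun t _ => ?_
  rw [← add_smul]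
  congr 1
  simp only [Pi.add_apply]
  ring

theorem Table.bracket_skew (T : Table) (x y : Fin 8 → ℝ) :
    T.bracket x y = - T.bracket y x := by
  have h : T.bracket x y + T.bracket y x = 0 := by
    simp only [Table.bracket, ← List.sum_map_add]
    refine List.sum_eq_zero fun v hv => ?_
    obtain ⟨t, _, rfl⟩ := List.mem_map.1 hv
    rw [← add_smul, show (x t.1 * y t.2.1 - x t.2.1 * y t.1 +
      (y t.1 * x t.2.1 - y t.2.1 * x t.1) : ℝ) = 0 by ring, zero_smul]
  exact eq_neg_of_add_eq_zero_left h

theorem Table.bracket_self (T : Table) (x : Fin 8 → ℝ) : T.bracket x x = 0 := by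
  refine List.sum_eq_zero fun v hv => ?_
  obtain ⟨t, _, rfl⟩ := List.mem_map.1 hv
  rw [mul_comm, sub_self, zero_smul]

theorem Table.bracket_add_right (T : Table) (x y y' : Fin 8 → ℝ) :
    T.bracket x (y + y') = T.bracket x y + T.bracket x y' := by
  rw [T.bracket_skew, T.bracket_add_left, neg_add, ← T.bracket_skew, ← T.bracket_skew]

theorem Table.bracket_smul_right (T : Table) (r : ℝ) (x y : Fin 8 → ℝ) :
    T.bracket x (r • y) = r • T.bracket x y := by
  simp only [Table.bracket, List.smul_sum, List.map_map]
  congr 1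
  refine List.map_congr_left fun t _ => ?_
  simp only [Function.comp_apply, smul_smul, Pi.smul_apply, smul_eq_mul]
  congr 1
  ring

instance (S : LieTable) : LieRing S.Alg where
  bracket x y := S.table.bracket x y
  add_lie := S.table.bracket_add_left
  lie_add := S.table.bracket_add_right
  lie_self := S.table.bracket_self
  leibniz_lie := S.jacobi

instance (S : LieTable) : LieAlgebra ℝ S.Alg where
  lie_smul := S.table.bracket_smul_right

theorem Table.jacobi_of (T : Table)
    (h : ∀ x y z u v w : Fin 8 → ℝ, (∀ k, u k = T.bracket y z k) → (∀ k, v k = T.bracket x y k) →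
      (∀ k, w k = T.bracket x z k) → ∀ k, T.bracket x u k = T.bracket v z k + T.bracket y w k)
    (x y z : Fin 8 → ℝ) :
    T.bracket x (T.bracket y z) = T.bracket (T.bracket x y) z + T.bracket y (T.bracket x z) :=
  funext fun k => h x y z _ _ _ (fun _ => rfl) (fun _ => rfl) (fun _ => rfl) k

theorem e_apply (i j : Fin 8) : e i j = if j = i then 1 else 0 := Pi.single_apply i 1 j

/-! ### Levi factors (spanned by `e 0, e 1, e 2`) and their modules -/

/-- `so(3)`. -/
def so3 : Table := [(0, 1, e 2), (1, 2, e 0), (2, 0, e 1)]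

/-- `sl(2, ℝ)`, with `e 0 = diag(1, -1)`, `e 1 = E₁₂`, `e 2 = E₂₁`. -/
def sl2 : Table := [(0, 1, (2 : ℝ) • e 1), (0, 2, (-2 : ℝ) • e 2), (1, 2, e 0)]

/-- The three-dimensional irreducible representation of `so(3)`, on `e 3, e 4, e 5`. -/
def R3 : Table :=
  [(0, 4, e 5), (0, 5, - e 4), (1, 5, e 3), (1, 3, - e 5), (2, 3, e 4), (2, 4, - e 3)]

/-- The four-dimensional irreducible real representation of `so(3)`, on `e 3, e 4, e 5, e 6`. -/
noncomputable def R4 : Table :=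
  [(0, 3, (1 / 2 : ℝ) • e 6), (0, 4, (1 / 2 : ℝ) • e 5),
   (0, 5, (-1 / 2 : ℝ) • e 4), (0, 6, (-1 / 2 : ℝ) • e 3),
   (1, 3, (1 / 2 : ℝ) • e 4), (1, 4, (-1 / 2 : ℝ) • e 3),
   (1, 5, (1 / 2 : ℝ) • e 6), (1, 6, (-1 / 2 : ℝ) • e 5),
   (2, 3, (1 / 2 : ℝ) • e 5), (2, 4, (-1 / 2 : ℝ) • e 6),
   (2, 5, (-1 / 2 : ℝ) • e 3), (2, 6, (1 / 2 : ℝ) • e 4)]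

/-- The two-dimensional irreducible representation of `sl(2, ℝ)`, on `e i, e j`. -/
def DHalf (i j : Fin 8) : Table :=
  [(0, i, e i), (0, j, - e j), (1, j, e i), (2, i, e j)]

/-- The three-dimensional irreducible representation of `sl(2, ℝ)`, on `e 3, e 4, e 5`. -/
def D1 : Table :=
  [(0, 3, (2 : ℝ) • e 3), (0, 5, (-2 : ℝ) • e 5),
   (1, 4, (2 : ℝ) • e 3), (1, 5, e 4), (2, 3, e 4), (2, 4, (2 : ℝ) • e 5)]

/-- The four-dimensional irreducible representation of `sl(2, ℝ)`, on `e 3, e 4, e 5, e 6`. -/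
def D3Half : Table :=
  [(0, 3, (3 : ℝ) • e 3), (0, 4, e 4), (0, 5, - e 5), (0, 6, (-3 : ℝ) • e 6),
   (1, 4, (3 : ℝ) • e 3), (1, 5, (2 : ℝ) • e 4), (1, 6, e 5),
   (2, 3, e 4), (2, 4, (2 : ℝ) • e 5), (2, 5, (3 : ℝ) • e 6)]

/-! ### The algebras -/

/-- `L_{8.1}` (`p ≠ 0`): `so(3) ⋊ A_{5.7}`. -/
noncomputable def L8_1 (p : ℝ) : LieTable where
  table := so3 ++ R3 ++
    [(7, 3, e 3), (7, 4, e 4), (7, 5, e 5), (7, 6, p • e 6)]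
  jacobi := by
    refine Table.jacobi_of _ fun x y z u v w => ?_
    simp [Table.bracket, so3, R3, e_apply, Fin.forall_fin_succ]
    intros
    simp only [*]
    (repeat' apply And.intro) <;> ring

/-- `L_{8.3}`: `so(3) ⋊ A_{5.7}`. -/
noncomputable def L8_3 : LieTable where
  table := so3 ++ R4 ++
    [(7, 3, e 3), (7, 4, e 4), (7, 5, e 5), (7, 6, e 6)]
  jacobi := by
    refine Table.jacobi_of _ fun x y z u v w => ?_
    simp [Table.bracket, so3, R4, e_apply, Fin.forall_fin_succ]
    intros
    simp only [*]
    (repeat' apply And.intro) <;> ring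

/-- `L_{8.4}`: `so(3) ⋊ A_{5.17}`. -/
noncomputable def L8_4 (p : ℝ) : LieTable where
  table := so3 ++ R4 ++
    [(7, 3, p • e 3 - e 5), (7, 5, e 3 + p • e 5), (7, 4, p • e 4 - e 6), (7, 6, e 4 + p • e 6)]
  jacobi := by
    refine Table.jacobi_of _ fun x y z u v w => ?_
    simp [Table.bracket, so3, R4, e_apply, Fin.forall_fin_succ]
    intros
    simp only [*]
    (repeat' apply And.intro) <;> ring

/-- `L_{8.7}` (`p q ≠ 0`): `sl(2, ℝ) ⋊ A_{5.7}`. -/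
noncomputable def L8_7 (p q : ℝ) : LieTable where
  table := sl2 ++ DHalf 3 4 ++
    [(7, 3, e 3), (7, 4, e 4), (7, 5, p • e 5), (7, 6, q • e 6)]
  jacobi := by
    refine Table.jacobi_of _ fun x y z u v w => ?_
    simp [Table.bracket, sl2, DHalf, e_apply, Fin.forall_fin_succ]
    intros
    simp only [*]
    (repeat' apply And.intro) <;> ring

/-- `L_{8.8}` (every `p`): `sl(2, ℝ) ⋊ A_{5.8}` for `p = 0`, `sl(2, ℝ) ⋊ A_{5.9}` for `p ≠ 0`. -/
noncomputable def L8_8 (p : ℝ) : LieTable where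
  table := sl2 ++ DHalf 3 4 ++
    [(7, 3, e 3), (7, 4, e 4), (7, 5, p • e 5), (7, 6, e 5 + p • e 6)]
  jacobi := by
    refine Table.jacobi_of _ fun x y z u v w => ?_
    simp [Table.bracket, sl2, DHalf, e_apply, Fin.forall_fin_succ]
    intros
    simp only [*]
    (repeat' apply And.intro) <;> ring

/-- `L_{8.9}` (`q ≠ 0`): `sl(2, ℝ) ⋊ A_{5.13}`. -/
noncomputable def L8_9 (p q : ℝ) : LieTable where
  table := sl2 ++ DHalf 3 4 ++
    [(7, 3, e 3), (7, 4, e 4), (7, 5, p • e 5 - q • e 6), (7, 6, q • e 5 + p • e 6)]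
  jacobi := by
    refine Table.jacobi_of _ fun x y z u v w => ?_
    simp [Table.bracket, sl2, DHalf, e_apply, Fin.forall_fin_succ]
    intros
    simp only [*]
    (repeat' apply And.intro) <;> ring

/-- `L_{8.10}` (`p ≠ 0`): `sl(2, ℝ) ⋊ A_{5.19}`. -/
noncomputable def L8_10 (p : ℝ) : LieTable where
  table := sl2 ++ DHalf 3 4 ++
    [(3, 4, e 5), (7, 3, e 3), (7, 4, e 4), (7, 5, (2 : ℝ) • e 5), (7, 6, p • e 6)]
  jacobi := by
    refine Table.jacobi_of _ fun x y z u v w => ?_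
    simp [Table.bracket, sl2, DHalf, e_apply, Fin.forall_fin_succ]
    intros
    simp only [*]
    (repeat' apply And.intro) <;> ring

/-- `L_{8.11}`: `sl(2, ℝ) ⋊ A_{5.20}`. -/
noncomputable def L8_11 : LieTable where
  table := sl2 ++ DHalf 3 4 ++
    [(3, 4, e 5), (7, 3, e 3), (7, 4, e 4), (7, 5, (2 : ℝ) • e 5), (7, 6, e 5 + (2 : ℝ) • e 6)]
  jacobi := by
    refine Table.jacobi_of _ fun x y z u v w => ?_
    simp [Table.bracket, sl2, DHalf, e_apply, Fin.forall_fin_succ]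
    intros
    simp only [*]
    (repeat' apply And.intro) <;> ring

/-- `L_{8.12}` (`p ≠ 0`): `sl(2, ℝ) ⋊ A_{5.7}`. -/
noncomputable def L8_12 (p : ℝ) : LieTable where
  table := sl2 ++ D1 ++
    [(7, 3, e 3), (7, 4, e 4), (7, 5, e 5), (7, 6, p • e 6)]
  jacobi := by
    refine Table.jacobi_of _ fun x y z u v w => ?_
    simp [Table.bracket, sl2, D1, e_apply, Fin.forall_fin_succ]
    intros
    simp only [*]
    (repeat' apply And.intro) <;> ring

/-- `L_{8.20}`: `sl(2, ℝ) ⋊ A_{5.7}`. -/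
noncomputable def L8_20 : LieTable where
  table := sl2 ++ D3Half ++
    [(7, 3, e 3), (7, 4, e 4), (7, 5, e 5), (7, 6, e 6)]
  jacobi := by
    refine Table.jacobi_of _ fun x y z u v w => ?_
    simp [Table.bracket, sl2, D3Half, e_apply, Fin.forall_fin_succ]
    intros
    simp only [*]
    (repeat' apply And.intro) <;> ring

/-- `L_{8.22}`: `sl(2, ℝ) ⋊ ℝ⁵`. -/
noncomputable def L8_22 : LieTable where
  table := sl2 ++ D1 ++ DHalf 6 7
  jacobi := by
    refine Table.jacobi_of _ fun x y z u v w => ?_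
    simp [Table.bracket, sl2, D1, DHalf, e_apply, Fin.forall_fin_succ]
    intros
    simp only [*]
    (repeat' apply And.intro) <;> ring

end Levi8

/-! ### `sl(2)`-triples of `4 × 4` matrices -/

open Matrix

/-! Upper bound: each algebra gets an explicit faithful `5 × 5` representation. Most are affine: the
Levi factor and `e 7` act linearly on an abelian ideal of translations. The two algebras with a
Heisenberg ideal and the one with abelian radical use other block triangular matrices.

Lower bound: a representation of dimension at most four is padded with zeros to size four and
restricted to the Levi factor. In characteristic zero an `sl(2)`-triple with `H ≠ 0` has one of the
types 4, 3+1, 2+2, 2+1+1 (`Sl2Rel.classification`). The radical sits in `gl(4)` as an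
`sl(2)`-module, so its weights are differences of diagonal entries of `H`. Weight three never
occurs, which excludes `D_{3/2}`. Weight one occurs only for 2+1+1, where the commutant of `sl(2)`
is `K ⊕ gl(2)`. With `D_{1/2}` on `e 3, e 4`, the vectors `e 5, e 6, e 7` lie in that commutant;
their brackets force `e 5` and `e 6` into `sl(2)`-blocks, where commuting elements are proportional
(`Sl2Rel.dependent`, `Sl2Rel.eq_zero_of_jordan`). If `D_1` is present as well, its highest weight
vector is a multiple of `E`, which generates a nonabelian submodule
(`Sl2Rel.eq_zero_of_weight_two`). For `D_1` with an eigenvector of `e 7` in the commutant, only type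
2+2 with `p = 1` survives (`Sl2Rel.weight_two_or`).

For `so(3)` the matrices are complexified. When `E² = 0`, the real matrices generate a quaternion
algebra acting on `ℝ⁴`. This excludes type 2+1+1, hence `R_4`; and it leaves no nonzero square-zero
matrix in the commutant, which disposes of the case `p = 1` for `R_3`. -/

/-- Commutation relations of the standard basis of `sl(2)`, for `4 × 4` matrices. -/
structure Sl2Rel {K : Type*} [Field K] (H E F : Matrix (Fin 4) (Fin 4) K) : Prop where
  hE : H * E = E * H + (2 : K) • E
  hF : H * F = F * H - (2 : K) • F
  eF : E * F = F * E + H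

namespace Sl2Rel

variable {K : Type*} [Field K] {H E F : Matrix (Fin 4) (Fin 4) K}

theorem conj (h : Sl2Rel H E F) {P : Matrix (Fin 4) (Fin 4) K} (hP : IsUnit P) :
    Sl2Rel (P⁻¹ * H * P) (P⁻¹ * E * P) (P⁻¹ * F * P) := by
  have hd : IsUnit P.det := (Matrix.isUnit_iff_isUnit_det P).1 hP
  have key : ∀ A B : Matrix (Fin 4) (Fin 4) K,
      (P⁻¹ * A * P) * (P⁻¹ * B * P) = P⁻¹ * (A * B) * P := fun A B => by
    simp only [Matrix.mul_assoc, Matrix.mul_nonsing_inv_cancel_left _ _ hd]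
  constructor
  · rw [key, key, h.hE]; simp [Matrix.mul_add, Matrix.add_mul]
  · rw [key, key, h.hF]; simp [Matrix.mul_sub, Matrix.sub_mul]
  · rw [key, key, h.eF]; simp [Matrix.mul_add, Matrix.add_mul]

theorem swap (h : Sl2Rel H E F) : Sl2Rel (-H) F E := by
  refine ⟨?_, ?_, ?_⟩
  · rw [neg_mul, h.hF, mul_neg]; abel
  · rw [neg_mul, h.hE, mul_neg]; abel
  · rw [h.eF]; abel

theorem H_E_vec (h : Sl2Rel H E F) (v : Fin 4 → K) :
    H *ᵥ (E *ᵥ v) = E *ᵥ (H *ᵥ v) + (2 : K) • (E *ᵥ v) := by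
  simp only [Matrix.mulVec_mulVec, h.hE, Matrix.add_mulVec, Matrix.smul_mulVec]

theorem H_F_vec (h : Sl2Rel H E F) (v : Fin 4 → K) :
    H *ᵥ (F *ᵥ v) = F *ᵥ (H *ᵥ v) - (2 : K) • (F *ᵥ v) := by
  simp only [Matrix.mulVec_mulVec, h.hF, Matrix.sub_mulVec, Matrix.smul_mulVec]

theorem E_F_vec (h : Sl2Rel H E F) (v : Fin 4 → K) :
    E *ᵥ (F *ᵥ v) = F *ᵥ (E *ᵥ v) + H *ᵥ v := by
  simp only [Matrix.mulVec_mulVec, h.eF, Matrix.add_mulVec]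

/-- The powers of `E` are eigenvectors of `ad H` for the distinct eigenvalues `2k`, so only finitely
many are nonzero. A nilpotent `4 × 4` matrix has characteristic polynomial `X⁴`, and Cayley–Hamilton
gives the exponent. -/
theorem E_pow_four [CharZero K] (h : Sl2Rel H E F) : E ^ 4 = 0 := by
  have hnil : IsNilpotent E := by
    by_contra hn
    have hne : ∀ k : ℕ, E ^ k ≠ 0 := fun k hk => hn ⟨k, hk⟩
    have hcomm : ∀ k : ℕ, H * E ^ k = E ^ k * H + (2 * k : K) • E ^ k := by
      intro k
      induction k with
      | zero => simp
      | succ k ih =>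
        rw [pow_succ, ← Matrix.mul_assoc, ih, Matrix.add_mul, Matrix.mul_assoc, h.hE]
        simp only [Matrix.mul_add, Matrix.mul_smul, Matrix.smul_mul, Matrix.mul_assoc]
        push_cast
        module
    let f : Module.End K (Matrix (Fin 4) (Fin 4) K) :=
      LinearMap.mulLeft K H - LinearMap.mulRight K H
    have hev : ∀ k : ℕ, f.HasEigenvalue (2 * k : K) := fun k =>
      Module.End.hasEigenvalue_of_hasEigenvector (x := E ^ k)
        ⟨Module.End.mem_eigenspace_iff.2 (by simp [f, hcomm k]), hne k⟩
    refine Set.infinite_of_injective_forall_mem (f := fun k : ℕ => (2 * k : K)) ?_ hev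
      f.finite_hasEigenvalue
    intro a b hab
    simpa using hab
  have h1 : IsNilpotent (Matrix.toLin' E) := hnil.map (Matrix.toLinAlgEquiv' (R := K))
  have h2 := (LinearMap.isNilpotent_iff_charpoly _).1 h1
  have h3 := Matrix.aeval_self_charpoly E
  rw [← Matrix.charpoly_toLin', h2] at h3
  simpa using h3

end Sl2Rel

/-! ### Bases of `K⁴` and the normal forms -/

theorem exists_isUnit_of_linearIndependent {K : Type*} [Field K] {v : Fin 4 → Fin 4 → K}
    (hv : LinearIndependent K v) : IsUnit (Matrix.of v)ᵀ := by
  rw [← Matrix.linearIndependent_cols_iff_isUnit]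
  exact hv

theorem mul_of_transpose_eq {K : Type*} [Field K] {v : Fin 4 → Fin 4 → K}
    {A B : Matrix (Fin 4) (Fin 4) K} (h : ∀ j, A *ᵥ v j = ∑ i, B i j • v i) :
    A * (Matrix.of v)ᵀ = (Matrix.of v)ᵀ * B := by
  ext i j
  have := congrFun (h j) i
  simp only [Matrix.mulVec, dotProduct, Finset.sum_apply, Pi.smul_apply, smul_eq_mul] at this
  simp only [Matrix.mul_apply, Matrix.transpose_apply, Matrix.of_apply, this]
  exact Finset.sum_congr rfl fun _ _ => mul_comm _ _

/-- The four nontrivial types of four-dimensional representations of `sl(2)`. -/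
inductive Sl2Normal {K : Type*} [Field K] : Matrix (Fin 4) (Fin 4) K → Matrix (Fin 4) (Fin 4) K →
    Matrix (Fin 4) (Fin 4) K → Prop
  | four : Sl2Normal !![3, 0, 0, 0; 0, 1, 0, 0; 0, 0, -1, 0; 0, 0, 0, -3]
      !![0, 3, 0, 0; 0, 0, 4, 0; 0, 0, 0, 3; 0, 0, 0, 0]
      !![0, 0, 0, 0; 1, 0, 0, 0; 0, 1, 0, 0; 0, 0, 1, 0]
  | three_one : Sl2Normal !![2, 0, 0, 0; 0, 0, 0, 0; 0, 0, -2, 0; 0, 0, 0, 0]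
      !![0, 2, 0, 0; 0, 0, 2, 0; 0, 0, 0, 0; 0, 0, 0, 0]
      !![0, 0, 0, 0; 1, 0, 0, 0; 0, 1, 0, 0; 0, 0, 0, 0]
  | two_two : Sl2Normal !![1, 0, 0, 0; 0, -1, 0, 0; 0, 0, 1, 0; 0, 0, 0, -1]
      !![0, 1, 0, 0; 0, 0, 0, 0; 0, 0, 0, 1; 0, 0, 0, 0]
      !![0, 0, 0, 0; 1, 0, 0, 0; 0, 0, 0, 0; 0, 0, 1, 0]
  | two_one_one : Sl2Normal !![1, 0, 0, 0; 0, -1, 0, 0; 0, 0, 0, 0; 0, 0, 0, 0]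
      !![0, 1, 0, 0; 0, 0, 0, 0; 0, 0, 0, 0; 0, 0, 0, 0]
      !![0, 0, 0, 0; 1, 0, 0, 0; 0, 0, 0, 0; 0, 0, 0, 0]

/-- Up to a change of basis, the matrices are one of the nontrivial normal forms. -/
def Sl2Conj {K : Type*} [Field K] (H E F : Matrix (Fin 4) (Fin 4) K) : Prop :=
  ∃ P H₀ E₀ F₀ : Matrix (Fin 4) (Fin 4) K, IsUnit P ∧ Sl2Normal H₀ E₀ F₀ ∧
    H * P = P * H₀ ∧ E * P = P * E₀ ∧ F * P = P * F₀

theorem exists_mulVec_ne_zero {K : Type*} [Field K] {A : Matrix (Fin 4) (Fin 4) K} (hA : A ≠ 0) :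
    ∃ u, A *ᵥ u ≠ 0 := by
  by_contra! h
  refine hA (Matrix.ext_of_mulVec_single fun i => ?_)
  rw [h, Matrix.zero_mulVec]

theorem linearIndependent_of_weights {K : Type*} [Field K]
    {H : Matrix (Fin 4) (Fin 4) K} {n : ℕ} {w : Fin n → K} (hw : Function.Injective w)
    {v : Fin n → Fin 4 → K} (hv : ∀ i, H *ᵥ v i = w i • v i) (h0 : ∀ i, v i ≠ 0) :
    LinearIndependent K v :=
  Module.End.eigenvectors_linearIndependent' (Matrix.toLin' H) w hw v fun i =>
    ⟨Module.End.mem_eigenspace_iff.2 (by simpa using hv i), h0 i⟩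

/-! ### Modules with a highest weight vector of weight three or two -/

namespace Sl2Rel

variable {K : Type*} [Field K] [CharZero K] {H E F : Matrix (Fin 4) (Fin 4) K}

/-- The vectors `v, Fv, F²v, F³v` have distinct weights 3, 1, -1, -3 and are nonzero because `E`
carries each back to a nonzero multiple of the preceding one. They therefore form a basis, in which
`E` has the coefficients 3, 4, 3. -/
theorem conj_four (h : Sl2Rel H E F) {v : Fin 4 → K} (hv : v ≠ 0) (hE : E *ᵥ v = 0)
    (hH : H *ᵥ v = (3 : K) • v) : Sl2Conj H E F := by
  have hH1 : H *ᵥ (F *ᵥ v) = (1 : K) • (F *ᵥ v) := by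
    rw [h.H_F_vec, hH, Matrix.mulVec_smul]; module
  have hH2 : H *ᵥ (F *ᵥ F *ᵥ v) = (-1 : K) • (F *ᵥ F *ᵥ v) := by
    rw [h.H_F_vec, hH1, Matrix.mulVec_smul]; module
  have hH3 : H *ᵥ (F *ᵥ F *ᵥ F *ᵥ v) = (-3 : K) • (F *ᵥ F *ᵥ F *ᵥ v) := by
    rw [h.H_F_vec, hH2, Matrix.mulVec_smul]; module
  have hE1 : E *ᵥ (F *ᵥ v) = (3 : K) • v := by
    rw [h.E_F_vec, hE, Matrix.mulVec_zero, hH, zero_add]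
  have hE2 : E *ᵥ (F *ᵥ F *ᵥ v) = (4 : K) • (F *ᵥ v) := by
    rw [h.E_F_vec, hE1, hH1, Matrix.mulVec_smul]; module
  have hE3 : E *ᵥ (F *ᵥ F *ᵥ F *ᵥ v) = (3 : K) • (F *ᵥ F *ᵥ v) := by
    rw [h.E_F_vec, hE2, hH2, Matrix.mulVec_smul]; module
  have hF4 : F *ᵥ (F *ᵥ F *ᵥ F *ᵥ v) = 0 := by
    have := congrArg (· *ᵥ v) h.swap.E_pow_four
    simpa [pow_succ, Matrix.mulVec_mulVec, Matrix.mul_assoc] using this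
  have h1 : F *ᵥ v ≠ 0 := fun h0 => by
    rw [h0, Matrix.mulVec_zero] at hE1; exact smul_ne_zero (by norm_num) hv hE1.symm
  have h2 : F *ᵥ F *ᵥ v ≠ 0 := fun h0 => by
    rw [h0, Matrix.mulVec_zero] at hE2; exact smul_ne_zero (by norm_num) h1 hE2.symm
  have h3 : F *ᵥ F *ᵥ F *ᵥ v ≠ 0 := fun h0 => by
    rw [h0, Matrix.mulVec_zero] at hE3; exact smul_ne_zero (by norm_num) h2 hE3.symm
  have hli : LinearIndependent K ![v, F *ᵥ v, F *ᵥ F *ᵥ v, F *ᵥ F *ᵥ F *ᵥ v] := by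
    refine linearIndependent_of_weights (H := H) (w := ![3, 1, -1, -3]) ?_ ?_ ?_
    · intro i j hij
      fin_cases i <;> fin_cases j <;> first | rfl | (exfalso; norm_num at hij)
    · simp [-Matrix.mulVec_mulVec, Fin.forall_fin_succ, hH, hH1, hH2, hH3]
    · simp [-Matrix.mulVec_mulVec, Fin.forall_fin_succ, hv, h1, h2, h3]
  refine ⟨_, _, _, _, exists_isUnit_of_linearIndependent hli, Sl2Normal.four,
    mul_of_transpose_eq ?_, mul_of_transpose_eq ?_, mul_of_transpose_eq ?_⟩
  · simp [-Matrix.mulVec_mulVec, Fin.forall_fin_succ, Fin.sum_univ_four, hH, hH1, hH2, hH3]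
  · simp [-Matrix.mulVec_mulVec, Fin.forall_fin_succ, Fin.sum_univ_four, hE, hE1, hE2, hE3]
  · simp [-Matrix.mulVec_mulVec, Fin.forall_fin_succ, Fin.sum_univ_four, hF4]

/-- Complete reducibility for a three-dimensional submodule with one-dimensional quotient, done by
hand: the triple acts by zero on the quotient, and the fourth basis vector can be corrected by an
element of the submodule so that the triple kills it. -/
theorem normalize_three_one {a b c : Fin 4 → K}
    (h : Sl2Rel !![2, 0, 0, a 0; 0, 0, 0, a 1; 0, 0, -2, a 2; 0, 0, 0, a 3]
      !![0, 2, 0, b 0; 0, 0, 2, b 1; 0, 0, 0, b 2; 0, 0, 0, b 3]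
      !![0, 0, 0, c 0; 1, 0, 0, c 1; 0, 1, 0, c 2; 0, 0, 0, c 3]) :
    Sl2Conj !![2, 0, 0, a 0; 0, 0, 0, a 1; 0, 0, -2, a 2; 0, 0, 0, a 3]
      !![0, 2, 0, b 0; 0, 0, 2, b 1; 0, 0, 0, b 2; 0, 0, 0, b 3]
      !![0, 0, 0, c 0; 1, 0, 0, c 1; 0, 1, 0, c 2; 0, 0, 0, c 3] := by
  have e1 := fun i => congrFun (congrFun h.hE i) 3
  have e2 := fun i => congrFun (congrFun h.hF i) 3
  have e3 := fun i => congrFun (congrFun h.eF i) 3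
  simp [Fin.forall_fin_succ, Matrix.mul_apply, Fin.sum_univ_four] at e1 e2 e3
  obtain ⟨e10, e11, e12, e13⟩ := e1
  obtain ⟨e20, e21, e22, e23⟩ := e2
  obtain ⟨e30, e31, e32, e33⟩ := e3
  have hb3 : b 3 = 0 := by linear_combination (-1 / 2) * e13
  have hc3 : c 3 = 0 := by linear_combination (1 / 2) * e23
  have ha3 : a 3 = 0 := by linear_combination c 3 * hb3 - b 3 * hc3 -e33
  simp only [hb3, hc3, ha3] at *
  -- The corrections `-c 1` and `-c 2` cancel the action of `F` on the fourth vector, and `-b 1 / 2`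
  -- cancels the middle coefficient of `E`; the commutation relations remove all that remains.
  refine ⟨!![1, 0, 0, -c 1; 0, 1, 0, -c 2; 0, 0, 1, -b 1 / 2; 0, 0, 0, 1], _, _, _, ?_,
    Sl2Normal.three_one, ?_, ?_, ?_⟩
  · rw [Matrix.isUnit_iff_isUnit_det]
    simp [Matrix.det_succ_row_zero, Fin.sum_univ_succ]
  all_goals
    ext i j
    fin_cases i <;> fin_cases j <;> simp [Matrix.mul_apply, Fin.sum_univ_four] <;> grind

omit [CharZero K] in
theorem _root_.Sl2Conj.of_conj {P : Matrix (Fin 4) (Fin 4) K} (hP : IsUnit P)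
    (h : Sl2Conj (P⁻¹ * H * P) (P⁻¹ * E * P) (P⁻¹ * F * P)) : Sl2Conj H E F := by
  obtain ⟨Q, H₀, E₀, F₀, hQ, hn, h1, h2, h3⟩ := h
  have hd : IsUnit P.det := (Matrix.isUnit_iff_isUnit_det P).1 hP
  have key : ∀ A A₀ : Matrix (Fin 4) (Fin 4) K, P⁻¹ * A * P * Q = Q * A₀ →
      A * (P * Q) = P * Q * A₀ := fun A A₀ hA => by
    rw [Matrix.mul_assoc P, ← hA]
    simp only [Matrix.mul_assoc, Matrix.mul_nonsing_inv_cancel_left _ _ hd]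
  exact ⟨P * Q, H₀, E₀, F₀, hP.mul hQ, hn, key _ _ h1, key _ _ h2, key _ _ h3⟩

theorem conj_three_one (h : Sl2Rel H E F) {v : Fin 4 → K} (hv : v ≠ 0) (hE : E *ᵥ v = 0)
    (hH : H *ᵥ v = (2 : K) • v) : Sl2Conj H E F := by
  have hH1 : H *ᵥ (F *ᵥ v) = 0 := by
    rw [h.H_F_vec, hH, Matrix.mulVec_smul]; module
  have hH2 : H *ᵥ (F *ᵥ F *ᵥ v) = (-2 : K) • (F *ᵥ F *ᵥ v) := by
    rw [h.H_F_vec, hH1, Matrix.mulVec_zero]; module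
  have hH3 : H *ᵥ (F *ᵥ F *ᵥ F *ᵥ v) = (-4 : K) • (F *ᵥ F *ᵥ F *ᵥ v) := by
    rw [h.H_F_vec, hH2, Matrix.mulVec_smul]; module
  have hE1 : E *ᵥ (F *ᵥ v) = (2 : K) • v := by
    rw [h.E_F_vec, hE, Matrix.mulVec_zero, hH, zero_add]
  have hE2 : E *ᵥ (F *ᵥ F *ᵥ v) = (2 : K) • (F *ᵥ v) := by
    rw [h.E_F_vec, hE1, hH1, Matrix.mulVec_smul]; module
  have hE3 : E *ᵥ (F *ᵥ F *ᵥ F *ᵥ v) = 0 := by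
    rw [h.E_F_vec, hE2, hH2, Matrix.mulVec_smul]; module
  have hF4 : F *ᵥ (F *ᵥ F *ᵥ F *ᵥ v) = 0 := by
    have := congrArg (· *ᵥ v) h.swap.E_pow_four
    simpa [pow_succ, Matrix.mulVec_mulVec, Matrix.mul_assoc] using this
  -- `F³v` is killed by `E` and has weight -4, so `E F⁴v = -4 F³v`, while `F⁴ = 0`.
  have hF3 : F *ᵥ (F *ᵥ F *ᵥ v) = 0 := by
    have h4 := h.E_F_vec (F *ᵥ F *ᵥ F *ᵥ v)
    rw [hF4, hE3, hH3, Matrix.mulVec_zero, Matrix.mulVec_zero, zero_add] at h4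
    exact (smul_eq_zero.1 h4.symm).resolve_left (by norm_num)
  have h1 : F *ᵥ v ≠ 0 := fun h0 => by
    rw [h0, Matrix.mulVec_zero] at hE1; exact smul_ne_zero (by norm_num) hv hE1.symm
  have h2 : F *ᵥ F *ᵥ v ≠ 0 := fun h0 => by
    rw [h0, Matrix.mulVec_zero] at hE2; exact smul_ne_zero (by norm_num) h1 hE2.symm
  have hli : LinearIndependent K ![v, F *ᵥ v, F *ᵥ F *ᵥ v] := by
    refine linearIndependent_of_weights (H := H) (w := ![2, 0, -2]) ?_ ?_ ?_
    · intro i j hij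
      fin_cases i <;> fin_cases j <;> first | rfl | (exfalso; norm_num at hij)
    · simp [-Matrix.mulVec_mulVec, Fin.forall_fin_succ, hH, hH1, hH2]
    · simp [-Matrix.mulVec_mulVec, Fin.forall_fin_succ, hv, h1, h2]
  obtain ⟨u, hu⟩ := exists_linearIndependent_snoc_of_lt_finrank hli (by simp)
  have hs : (Fin.snoc ![v, F *ᵥ v, F *ᵥ F *ᵥ v] u : Fin 4 → Fin 4 → K) =
      ![v, F *ᵥ v, F *ᵥ F *ᵥ v, u] := by
    ext i; fin_cases i <;> rfl
  rw [hs] at hu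
  have hP := exists_isUnit_of_linearIndependent hu
  set P := (Matrix.of ![v, F *ᵥ v, F *ᵥ F *ᵥ v, u])ᵀ with hPdef
  have hd : IsUnit P.det := (Matrix.isUnit_iff_isUnit_det P).1 hP
  -- Three columns of the conjugated matrix are prescribed by the submodule; the fourth, coming from
  -- an arbitrary complementary vector, stays unknown.
  have col : ∀ A : Matrix (Fin 4) (Fin 4) K, ∀ x : Fin 3 → Fin 4 → K,
      A *ᵥ v = ∑ i, x 0 i • P.col i → A *ᵥ (F *ᵥ v) = ∑ i, x 1 i • P.col i →
      A *ᵥ (F *ᵥ F *ᵥ v) = ∑ i, x 2 i • P.col i → P⁻¹ * A * P =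
        !![x 0 0, x 1 0, x 2 0, (P⁻¹ * A * P) 0 3; x 0 1, x 1 1, x 2 1, (P⁻¹ * A * P) 1 3;
          x 0 2, x 1 2, x 2 2, (P⁻¹ * A * P) 2 3; x 0 3, x 1 3, x 2 3, (P⁻¹ * A * P) 3 3] := by
    intro A x h0 h1 h2
    have key : ∀ (y : Fin 4 → K) (j : Fin 4), A *ᵥ P.col j = ∑ i, y i • P.col i →
        ∀ k, (P⁻¹ * A * P) k j = y k := by
      intro y j hy k
      have : P⁻¹ *ᵥ (A *ᵥ P.col j) = y := by
        rw [hy, show ∑ i, y i • P.col i = P *ᵥ y by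
          ext k; simp [Matrix.mulVec, dotProduct, mul_comm], Matrix.mulVec_mulVec,
          Matrix.nonsing_inv_mul _ hd, Matrix.one_mulVec]
      rw [← this, Matrix.mul_assoc]
      simp [Matrix.mul_apply, Matrix.mulVec, dotProduct]
    have k0 := key (x 0) 0 h0
    have k1 := key (x 1) 1 h1
    have k2 := key (x 2) 2 h2
    ext i j
    fin_cases i <;> fin_cases j <;> first | rfl | exact k0 _ | exact k1 _ | exact k2 _
  have c0 : P.col 0 = v := rfl
  have c1 : P.col 1 = F *ᵥ v := rfl
  have c2 : P.col 2 = F *ᵥ F *ᵥ v := rfl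
  have hHP := col H ![![2, 0, 0, 0], 0, ![0, 0, -2, 0]]
    (by simp [-Matrix.mulVec_mulVec, Fin.sum_univ_four, c0, c1, c2, hH])
    (by simp [-Matrix.mulVec_mulVec, hH1])
    (by simp [-Matrix.mulVec_mulVec, Fin.sum_univ_four, c0, c1, c2, hH2])
  have hEP := col E ![0, ![2, 0, 0, 0], ![0, 2, 0, 0]]
    (by simp [-Matrix.mulVec_mulVec, hE])
    (by simp [-Matrix.mulVec_mulVec, Fin.sum_univ_four, c0, c1, c2, hE1])
    (by simp [-Matrix.mulVec_mulVec, Fin.sum_univ_four, c0, c1, c2, hE2])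
  have hFP := col F ![![0, 1, 0, 0], ![0, 0, 1, 0], 0]
    (by simp [-Matrix.mulVec_mulVec, Fin.sum_univ_four, c0, c1, c2])
    (by simp [-Matrix.mulVec_mulVec, Fin.sum_univ_four, c0, c1, c2])
    (by simp [-Matrix.mulVec_mulVec, hF3])
  refine Sl2Conj.of_conj hP ?_
  have hrel := h.conj hP
  rw [hHP, hEP, hFP] at hrel ⊢
  exact normalize_three_one (a := fun i => (P⁻¹ * H * P) i 3) (b := fun i => (P⁻¹ * E * P) i 3)
    (c := fun i => (P⁻¹ * F * P) i 3) hrel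

end Sl2Rel

/-! ### Modules with `E² = 0`, and the classification -/

namespace Sl2Rel

variable {K : Type*} [Field K] [CharZero K] {H E F : Matrix (Fin 4) (Fin 4) K}

/-- Expanding `0 = E(EF)` with `EF = FE + H` gives `HE + EH = 0`; adding `HE - EH = 2E` yields twice
the claim. -/
theorem H_mul_E (h : Sl2Rel H E F) (h2 : E * E = 0) : H * E = E := by
  have h3 : E * (E * F) = 0 := by rw [← Matrix.mul_assoc, h2, Matrix.zero_mul]
  rw [h.eF, Matrix.mul_add, ← Matrix.mul_assoc, h.eF, Matrix.add_mul, Matrix.mul_assoc, h2,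
    Matrix.mul_zero, zero_add] at h3
  have h4 : (2 : K) • (H * E) = (2 : K) • E := by
    rw [two_smul]
    nth_rw 2 [h.hE]
    rw [← add_assoc, h3, zero_add]
  exact smul_right_injective _ (two_ne_zero' K) h4

theorem H_cube (h : Sl2Rel H E F) (h2 : E * E = 0) : H * (H * H) = H := by
  have hHE := h.H_mul_E h2
  have hH : H = E * F - F * E := by rw [h.eF]; abel
  have h1 : H * (E * F) = E * F := by rw [← Matrix.mul_assoc, hHE]
  have h3 : H * (F * E) = - (F * E) := by
    rw [← Matrix.mul_assoc, h.hF, Matrix.sub_mul, Matrix.mul_assoc, hHE, Matrix.smul_mul]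
    module
  have h4 : H * H = E * F + F * E := by
    nth_rw 2 [hH]
    rw [Matrix.mul_sub, h1, h3]
    abel
  rw [h4, Matrix.mul_add, h1, h3, hH]
  abel

/-- Since `H³ = H`, the only possible weights are 0, 1 and -1. -/
theorem eq_zero_of_weight (h : Sl2Rel H E F) (h2 : E * E = 0) {x : Fin 4 → K} {c : K}
    (hx : H *ᵥ x = c • x) (hc : c * c * c ≠ c) : x = 0 := by
  have h3 := congrArg (· *ᵥ x) (h.H_cube h2)
  simp only [← Matrix.mulVec_mulVec, hx, Matrix.mulVec_smul, smul_smul] at h3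
  rw [← sub_eq_zero, ← sub_smul] at h3
  exact (smul_eq_zero.1 h3).resolve_left (sub_ne_zero.2 hc)

/-- `H³ = H` splits every vector into weight vectors: `v - H²v`, `(H²v + Hv)/2` and `(H²v - Hv)/2`
have weights 0, 1, -1. They cannot all lie in a proper subspace for every `v`. -/
theorem exists_weight_notMem (h : Sl2Rel H E F) (h2 : E * E = 0) {p : Submodule K (Fin 4 → K)}
    (hp : p ≠ ⊤) : (∃ x, H *ᵥ x = x ∧ x ∉ p) ∨ (∃ x, H *ᵥ x = 0 ∧ x ∉ p) ∨
      (∃ x, H *ᵥ x = -x ∧ x ∉ p) := by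
  by_contra! hcon
  obtain ⟨h1, h0, hm⟩ := hcon
  refine hp (Submodule.eq_top_iff'.2 fun v => ?_)
  have h3 : H *ᵥ (H *ᵥ H *ᵥ v) = H *ᵥ v := by
    simp only [Matrix.mulVec_mulVec, h.H_cube h2]
  have e1 := h1 (H *ᵥ H *ᵥ v + H *ᵥ v) (by rw [Matrix.mulVec_add, h3, add_comm])
  have e0 := h0 (v - H *ᵥ H *ᵥ v) (by rw [Matrix.mulVec_sub, h3, sub_self])
  have em := hm (H *ᵥ H *ᵥ v - H *ᵥ v) (by rw [Matrix.mulVec_sub, h3, neg_sub])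
  have : v = (v - H *ᵥ H *ᵥ v) + ((1 / 2 : K) • (H *ᵥ H *ᵥ v + H *ᵥ v) +
      (1 / 2 : K) • (H *ᵥ H *ᵥ v - H *ᵥ v)) := by module
  rw [this]
  exact p.add_mem e0 (p.add_mem (p.smul_mem _ e1) (p.smul_mem _ em))

theorem pair_weights (h : Sl2Rel H E F) (h2 : E * E = 0) {x : Fin 4 → K} (hx : H *ᵥ x = x) :
    E *ᵥ x = 0 ∧ H *ᵥ (F *ᵥ x) = - (F *ᵥ x) ∧ E *ᵥ (F *ᵥ x) = x ∧ F *ᵥ (F *ᵥ x) = 0 := by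
  have hE : E *ᵥ x = 0 := by
    refine h.eq_zero_of_weight h2 (c := 3) ?_ (by norm_num)
    rw [h.H_E_vec, hx]; module
  have hF : H *ᵥ (F *ᵥ x) = - (F *ᵥ x) := by
    rw [h.H_F_vec, hx]; module
  refine ⟨hE, hF, ?_, ?_⟩
  · rw [h.E_F_vec, hE, hx, Matrix.mulVec_zero, zero_add]
  · refine h.eq_zero_of_weight h2 (c := -3) ?_ (by norm_num)
    rw [h.H_F_vec, hF, Matrix.mulVec_neg]; module

theorem pair_weights_neg (h : Sl2Rel H E F) (h2 : E * E = 0) {x : Fin 4 → K}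
    (hx : H *ᵥ x = -x) : H *ᵥ (E *ᵥ x) = E *ᵥ x ∧ F *ᵥ (E *ᵥ x) = x := by
  have hF : F *ᵥ x = 0 := by
    refine h.eq_zero_of_weight h2 (c := -3) ?_ (by norm_num)
    rw [h.H_F_vec, hx, Matrix.mulVec_neg]; module
  refine ⟨?_, ?_⟩
  · rw [h.H_E_vec, hx, Matrix.mulVec_neg]; module
  · have := h.E_F_vec x
    rw [hF, hx, Matrix.mulVec_zero] at this
    exact add_neg_eq_zero.1 this.symm

theorem weight_zero (h : Sl2Rel H E F) (h2 : E * E = 0) {x : Fin 4 → K} (hx : H *ᵥ x = 0) :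
    E *ᵥ x = 0 ∧ F *ᵥ x = 0 := by
  constructor
  · refine h.eq_zero_of_weight h2 (c := 2) ?_ (by norm_num)
    rw [h.H_E_vec, hx, Matrix.mulVec_zero, zero_add]
  · refine h.eq_zero_of_weight h2 (c := -2) ?_ (by norm_num)
    rw [h.H_F_vec, hx, Matrix.mulVec_zero]; module

theorem conj_two_two (h : Sl2Rel H E F) (h2 : E * E = 0) {v s : Fin 4 → K} (hv : v ≠ 0)
    (hH : H *ᵥ v = v) (hs : H *ᵥ s = s) (hns : ∀ c : K, s ≠ c • v) : Sl2Conj H E F := by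
  obtain ⟨v1, v2, v3, v4⟩ := h.pair_weights h2 hH
  obtain ⟨s1, s2, s3, s4⟩ := h.pair_weights h2 hs
  have hvs : LinearIndependent K ![v, s] :=
    (LinearIndependent.pair_iff' hv).2 fun c hc => hns c hc.symm
  rw [LinearIndependent.pair_iff] at hvs
  have hli : LinearIndependent K ![v, F *ᵥ v, s, F *ᵥ s] := by
    rw [Fintype.linearIndependent_iff]
    intro g hg
    simp only [Fin.sum_univ_four, Matrix.cons_val] at hg
    -- `E` kills `v` and `s` and sends `Fv`, `Fs` to `v`, `s`, so it isolates the coefficients of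
    -- the lower vectors.
    have hE := congrArg (E *ᵥ ·) hg
    simp only [Matrix.mulVec_add, Matrix.mulVec_smul, v1, v3, s1, s3, smul_zero, zero_add, add_zero,
      Matrix.mulVec_zero] at hE
    obtain ⟨g1, g3⟩ := hvs _ _ hE
    rw [g1, g3, zero_smul, zero_smul, add_zero, add_zero] at hg
    obtain ⟨g0, g2⟩ := hvs _ _ hg
    simp [Fin.forall_fin_succ, g0, g1, g2, g3]
  refine ⟨_, _, _, _, exists_isUnit_of_linearIndependent hli, Sl2Normal.two_two,
    mul_of_transpose_eq ?_, mul_of_transpose_eq ?_, mul_of_transpose_eq ?_⟩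
  · simp [-Matrix.mulVec_mulVec, Fin.forall_fin_succ, Fin.sum_univ_four, hH, hs, v2, s2]
  · simp [-Matrix.mulVec_mulVec, Fin.forall_fin_succ, Fin.sum_univ_four, v1, v3, s1, s3]
  · simp [-Matrix.mulVec_mulVec, Fin.forall_fin_succ, Fin.sum_univ_four, v4, s4]

/-- There is a vector `v` of weight one. If the weight-one space has a second independent vector,
the type is 2+2. Otherwise the weight spaces for 1 and -1 are the lines through `v` and `Fv`, and
the basis is completed by vectors of weight zero, on which the triple vanishes. -/
theorem conj_of_sq_eq_zero (h : Sl2Rel H E F) (h2 : E * E = 0) (hH : H ≠ 0) :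
    Sl2Conj H E F := by
  obtain ⟨v, hv, hHv⟩ : ∃ v, v ≠ 0 ∧ H *ᵥ v = v := by
    have hker : LinearMap.ker (Matrix.toLin' H) ≠ ⊤ := by
      intro hk
      rw [LinearMap.ker_eq_top] at hk
      exact hH (by simpa using hk)
    rcases h.exists_weight_notMem h2 hker with ⟨x, hx, hxp⟩ | ⟨x, hx, hxp⟩ | ⟨x, hx, hxp⟩
    · exact ⟨x, fun h0 => hxp (h0 ▸ Submodule.zero_mem _), hx⟩
    · exact absurd (by simpa using hx) hxp
    · refine ⟨E *ᵥ x, fun h0 => hxp ?_, (h.pair_weights_neg h2 hx).1⟩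
      have := (h.pair_weights_neg h2 hx).2
      rw [h0, Matrix.mulVec_zero] at this
      exact this ▸ Submodule.zero_mem _
  obtain ⟨v1, v2, v3, v4⟩ := h.pair_weights h2 hHv
  have hF : F *ᵥ v ≠ 0 := fun h0 => hv (by rw [← v3, h0, Matrix.mulVec_zero])
  by_cases hex : ∃ s, H *ᵥ s = s ∧ ∀ c : K, s ≠ c • v
  · obtain ⟨s, hs, hns⟩ := hex
    exact h.conj_two_two h2 hv hHv hs hns
  push Not at hex
  -- A weight vector outside a span containing `v` and `Fv` must have weight zero: weight one gives
  -- a multiple of `v`, and `x` of weight -1 equals `F(Ex)`, a multiple of `Fv`.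
  have step : ∀ (n : ℕ) (w : Fin n → Fin 4 → K), n < 4 → LinearIndependent K w →
      v ∈ Set.range w → F *ᵥ v ∈ Set.range w →
      ∃ u, H *ᵥ u = 0 ∧ LinearIndependent K (Fin.cons u w : Fin (n + 1) → Fin 4 → K) := by
    intro n w hn hw h0 h1
    have hp : Submodule.span K (Set.range w) ≠ ⊤ := by
      intro htop
      have := finrank_range_le_card (R := K) w
      rw [Set.finrank, htop, finrank_top] at this
      simp at this
      omega
    rcases h.exists_weight_notMem h2 hp with ⟨x, hx, hxp⟩ | ⟨x, hx, hxp⟩ | ⟨x, hx, hxp⟩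
    · obtain ⟨c, rfl⟩ := hex x hx
      exact absurd (Submodule.smul_mem _ _ (Submodule.subset_span h0)) hxp
    · exact ⟨x, hx, linearIndependent_finCons.2 ⟨hw, hxp⟩⟩
    · obtain ⟨y1, y2⟩ := h.pair_weights_neg h2 hx
      obtain ⟨c, hc⟩ := hex _ y1
      rw [hc, Matrix.mulVec_smul] at y2
      exact absurd (y2 ▸ Submodule.smul_mem _ _ (Submodule.subset_span h1)) hxp
  have hli : LinearIndependent K ![v, F *ᵥ v] := by
    refine linearIndependent_of_weights (H := H) (w := ![1, -1]) ?_ ?_ ?_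
    · intro i j hij
      fin_cases i <;> fin_cases j <;> first | rfl | (exfalso; norm_num at hij)
    · simp [-Matrix.mulVec_mulVec, Fin.forall_fin_succ, hHv, v2]
    · simp [-Matrix.mulVec_mulVec, Fin.forall_fin_succ, hv, hF]
  obtain ⟨u, hu, hli⟩ := step 2 _ (by norm_num) hli ⟨0, rfl⟩ ⟨1, rfl⟩
  obtain ⟨t, ht, hli⟩ := step 3 _ (by norm_num) hli ⟨1, rfl⟩ ⟨2, rfl⟩
  -- New vectors were put in front, so the family at hand is ordered `t, u, v, Fv`.
  have hli' : LinearIndependent K ![v, F *ᵥ v, u, t] := by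
    have := hli.comp ![2, 3, 1, 0] (by decide)
    convert! this using 1
    ext i; fin_cases i <;> rfl
  obtain ⟨u1, u2⟩ := h.weight_zero h2 hu
  obtain ⟨t1, t2⟩ := h.weight_zero h2 ht
  refine ⟨_, _, _, _, exists_isUnit_of_linearIndependent hli', Sl2Normal.two_one_one,
    mul_of_transpose_eq ?_, mul_of_transpose_eq ?_, mul_of_transpose_eq ?_⟩
  · simp [-Matrix.mulVec_mulVec, Fin.forall_fin_succ, Fin.sum_univ_four, hHv, v2, hu, ht]
  · simp [-Matrix.mulVec_mulVec, Fin.forall_fin_succ, Fin.sum_univ_four, v1, v3, u1, t1]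
  · simp [-Matrix.mulVec_mulVec, Fin.forall_fin_succ, Fin.sum_univ_four, v4, u2, t2]

theorem commute_pow (h : Sl2Rel H E F) (n : ℕ) :
    H * E ^ n = E ^ n * H + (2 * n : K) • E ^ n ∧
      E ^ (n + 1) * F = F * E ^ (n + 1) + (n + 1 : K) • (E ^ n * H) + (n * (n + 1) : K) • E ^ n := by
  induction n with
  | zero => simp [h.eF]
  | succ n ih =>
    have h1 : H * E ^ (n + 1) = E ^ (n + 1) * H + (2 * (n + 1 : ℕ) : K) • E ^ (n + 1) := by
      rw [pow_succ, ← Matrix.mul_assoc, ih.1, Matrix.add_mul, Matrix.mul_assoc, h.hE]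
      simp only [Matrix.mul_add, Matrix.mul_smul, Matrix.smul_mul, Matrix.mul_assoc]
      push_cast
      module
    refine ⟨h1, ?_⟩
    rw [pow_succ' E (n + 1), Matrix.mul_assoc, ih.2]
    simp only [Matrix.mul_add, Matrix.mul_smul, ← Matrix.mul_assoc, h.eF, ← pow_succ',
      Matrix.add_mul, h1]
    rw [Matrix.mul_assoc F, ← pow_succ']
    push_cast
    module

/-- With `E^(n+1) = 0` the formula for `E^(n+1) F` reduces to `(n+1)(E^n H + n E^n) = 0`. Thus every
vector in the image of the last nonzero power of `E` has weight `n`, which makes that exponent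
decide the type. -/
theorem H_mul_top_pow (h : Sl2Rel H E F) {n : ℕ} (hn : E ^ (n + 1) = 0) :
    H * E ^ n = (n : K) • E ^ n := by
  obtain ⟨h1, h3⟩ := h.commute_pow n
  rw [hn, Matrix.zero_mul, Matrix.mul_zero, zero_add, mul_comm, mul_smul, ← smul_add] at h3
  have h4 := (smul_eq_zero.1 h3.symm).resolve_left (by exact_mod_cast n.succ_ne_zero)
  rw [h1, eq_neg_of_add_eq_zero_left h4]
  module

/-- Classification of the four-dimensional representations of `sl(2)`. -/
theorem classification (h : Sl2Rel H E F) (hH : H ≠ 0) : Sl2Conj H E F := by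
  have top : ∀ n : ℕ, E ^ (n + 1) = 0 → E ^ n ≠ 0 →
      ∃ v, v ≠ 0 ∧ E *ᵥ v = 0 ∧ H *ᵥ v = (n : K) • v := by
    intro n h0 h1
    obtain ⟨u, hu⟩ := exists_mulVec_ne_zero h1
    refine ⟨E ^ n *ᵥ u, hu, ?_, ?_⟩
    · rw [Matrix.mulVec_mulVec, ← pow_succ', h0, Matrix.zero_mulVec]
    · rw [Matrix.mulVec_mulVec, h.H_mul_top_pow h0, Matrix.smul_mulVec]
  by_cases h3 : E ^ 3 = 0
  · by_cases h2 : E ^ 2 = 0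
    · exact h.conj_of_sq_eq_zero (by rwa [← sq]) hH
    · obtain ⟨v, hv, hE, hv'⟩ := top 2 h3 h2
      exact h.conj_three_one hv hE (by simpa using hv')
  · obtain ⟨v, hv, hE, hv'⟩ := top 3 h.E_pow_four h3
    exact h.conj_four hv hE (by simpa using hv')

end Sl2Rel

/-! ### Weights of `gl(4)` for the normal forms -/

/-- Conjugation by an invertible matrix, as an algebra automorphism. -/
noncomputable def conjAlgEquiv {K : Type*} [Field K] (P : (Matrix (Fin 4) (Fin 4) K)ˣ) :
    Matrix (Fin 4) (Fin 4) K ≃ₐ[K] Matrix (Fin 4) (Fin 4) K :=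
  MulSemiringAction.toAlgEquiv K _ (ConjAct.toConjAct P)

theorem Sl2Conj.exists_algEquiv {K : Type*} [Field K] {H E F : Matrix (Fin 4) (Fin 4) K}
    (h : Sl2Conj H E F) : ∃ c : Matrix (Fin 4) (Fin 4) K ≃ₐ[K] Matrix (Fin 4) (Fin 4) K,
      Sl2Normal (c H) (c E) (c F) := by
  obtain ⟨P, H₀, E₀, F₀, ⟨u, rfl⟩, hn, h1, h2, h3⟩ := h
  refine ⟨conjAlgEquiv u⁻¹, ?_⟩
  have key : ∀ A A₀ : Matrix (Fin 4) (Fin 4) K, A * u = u * A₀ → conjAlgEquiv u⁻¹ A = A₀ := by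
    intro A A₀ hA
    change ((u⁻¹ : (Matrix (Fin 4) (Fin 4) K)ˣ) : Matrix (Fin 4) (Fin 4) K) * A *
      ((u⁻¹⁻¹ : (Matrix (Fin 4) (Fin 4) K)ˣ) : Matrix (Fin 4) (Fin 4) K) = A₀
    rw [inv_inv, mul_assoc, hA, Units.inv_mul_cancel_left]
  rwa [key H H₀ h1, key E E₀ h2, key F F₀ h3]

namespace Sl2Normal

variable {K : Type*} [Field K] [CharZero K] {H E F A : Matrix (Fin 4) (Fin 4) K}

omit [CharZero K] in
theorem apply_eq_zero {d : Fin 4 → K} {w : K} (hA : diagonal d * A = A * diagonal d + w • A)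
    {i j : Fin 4} (h : d i - d j ≠ w) : A i j = 0 := by
  have := congrFun (congrFun hA i) j
  simp only [diagonal_mul, Matrix.add_apply, mul_diagonal, Matrix.smul_apply, smul_eq_mul] at this
  exact (mul_eq_zero.1 (show (d i - d j - w) * A i j = 0 by linear_combination this)).resolve_left
    (sub_ne_zero.2 h)

omit [CharZero K] in
theorem exists_diagonal (h : Sl2Normal H E F) : ∃ d, H = diagonal d ∧
    (d = ![3, 1, -1, -3] ∨ d = ![2, 0, -2, 0] ∨ d = ![1, -1, 1, -1] ∨ d = ![1, -1, 0, 0]) := by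
  cases h
  · exact ⟨![3, 1, -1, -3], by ext i j; fin_cases i <;> fin_cases j <;> rfl, by simp⟩
  · exact ⟨![2, 0, -2, 0], by ext i j; fin_cases i <;> fin_cases j <;> rfl, by simp⟩
  · exact ⟨![1, -1, 1, -1], by ext i j; fin_cases i <;> fin_cases j <;> rfl, by simp⟩
  · exact ⟨![1, -1, 0, 0], by ext i j; fin_cases i <;> fin_cases j <;> rfl, by simp⟩

/-- An entry `(i, j)` of `A` can be nonzero only if `d i - d j = 3`; in the first three types all
differences are even, and in 2+1+1 they are at most two. -/
theorem eq_zero_of_weight_three (h : Sl2Normal H E F) (hA : H * A = A * H + (3 : K) • A) :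
    A = 0 := by
  obtain ⟨d, rfl, hd⟩ := h.exists_diagonal
  ext i j
  refine apply_eq_zero hA ?_
  rcases hd with rfl | rfl | rfl | rfl <;> fin_cases i <;> fin_cases j <;> simp <;> norm_num

/-- Only the type 2+1+1 mixes even and odd weights, so only there do two diagonal entries of `H`
differ by one. -/
theorem eq_of_weight_one (h : Sl2Normal H E F) (hA : H * A = A * H + (1 : K) • A) (h0 : A ≠ 0) :
    H = !![1, 0, 0, 0; 0, -1, 0, 0; 0, 0, 0, 0; 0, 0, 0, 0] ∧
    E = !![0, 1, 0, 0; 0, 0, 0, 0; 0, 0, 0, 0; 0, 0, 0, 0] ∧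
    F = !![0, 0, 0, 0; 1, 0, 0, 0; 0, 0, 0, 0; 0, 0, 0, 0] := by
  obtain ⟨d, hd, hd'⟩ := h.exists_diagonal
  by_cases h1 : d = ![1, -1, 0, 0]
  · subst h1
    have := congrFun (congrFun hd 2) 2
    have := congrFun (congrFun hd 1) 1
    cases h <;> simp_all
  · refine absurd ?_ h0
    subst hd
    ext i j
    refine apply_eq_zero hA ?_
    rcases hd' with rfl | rfl | rfl | rfl
    · fin_cases i <;> fin_cases j <;> simp <;> norm_num
    · fin_cases i <;> fin_cases j <;> simp <;> norm_num
    · fin_cases i <;> fin_cases j <;> simp <;> norm_num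
    · exact absurd rfl h1

end Sl2Normal

/-! ### Commutants of the normal forms and their brackets -/

section TwoOneOne

variable {K : Type*} [Field K] [CharZero K] {X Y Z A : Matrix (Fin 4) (Fin 4) K}

omit [CharZero K] in
theorem commutant_two_one_one
    (hE : !![0, 1, 0, 0; 0, 0, 0, 0; 0, 0, 0, 0; 0, 0, 0, 0] * X =
      X * !![0, 1, 0, 0; 0, 0, 0, 0; 0, 0, 0, 0; 0, 0, 0, 0])
    (hF : !![0, 0, 0, 0; 1, 0, 0, 0; 0, 0, 0, 0; 0, 0, 0, 0] * X =
      X * !![0, 0, 0, 0; 1, 0, 0, 0; 0, 0, 0, 0; 0, 0, 0, 0]) :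
    ∃ x a b c d, X = !![x, 0, 0, 0; 0, x, 0, 0; 0, 0, a, b; 0, 0, c, d] := by
  have e := fun i j => congrFun (congrFun hE i) j
  have f := fun i j => congrFun (congrFun hF i) j
  simp [Fin.forall_fin_succ, Matrix.mul_apply, Fin.sum_univ_four] at e f
  refine ⟨X 0 0, X 2 2, X 2 3, X 3 2, X 3 3, ?_⟩
  ext i j
  fin_cases i <;> fin_cases j <;> simp <;> grind

end TwoOneOne

section

variable {K : Type*} [Field K]

/-- The hypotheses say that the cross product of two vectors of `K³` vanishes. For coordinates of
traceless `2 × 2` matrices this is commutativity. -/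
theorem exists_ratio {a b c a' b' c' : K} (h1 : b * c' = b' * c) (h2 : a * b' = a' * b)
    (h3 : a * c' = a' * c) (h : ¬ (a = 0 ∧ b = 0 ∧ c = 0)) :
    ∃ r, a' = r * a ∧ b' = r * b ∧ c' = r * c := by
  by_cases ha : a = 0
  · by_cases hb : b = 0
    · have hc : c ≠ 0 := fun hc => h ⟨ha, hb, hc⟩
      refine ⟨c' / c, ?_, ?_, ?_⟩ <;> field_simp <;>
        first | linear_combination -h1 | linear_combination -h3
    · refine ⟨b' / b, ?_, ?_, ?_⟩ <;> field_simp <;> first | linear_combination h1 | linear_combination -h2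
  · refine ⟨a' / a, ?_, ?_, ?_⟩ <;> field_simp <;> first | linear_combination h2 | linear_combination h3

variable [CharZero K]

/-- The scalar parts and block traces of commutators vanish, so an invertible linear system forces
`x = x' = 0` and makes both blocks traceless. Commuting elements of `sl(2)` are proportional. -/
theorem dependent_blocks {x a b c d x' a' b' c' d' x'' a'' b'' c'' d'' s t u v : K}
    {X Y Z : Matrix (Fin 4) (Fin 4) K}
    (hXe : X = !![x, 0, 0, 0; 0, x, 0, 0; 0, 0, a, b; 0, 0, c, d])
    (hYe : Y = !![x', 0, 0, 0; 0, x', 0, 0; 0, 0, a', b'; 0, 0, c', d'])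
    (hZe : Z = !![x'', 0, 0, 0; 0, x'', 0, 0; 0, 0, a'', b''; 0, 0, c'', d''])
    (hXY : X * Y = Y * X) (hX : Z * X - X * Z = s • X + t • Y)
    (hY : Z * Y - Y * Z = u • X + v • Y) (hdet : s * v - t * u ≠ 0) :
    X = 0 ∨ ∃ r : K, Y = r • X := by
  have e := fun i j => congrFun (congrFun hXY i) j
  have f := fun i j => congrFun (congrFun hX i) j
  have g := fun i j => congrFun (congrFun hY i) j
  simp only [hXe, hYe, hZe, Matrix.mul_apply, Fin.sum_univ_four, Matrix.sub_apply,
    Matrix.add_apply, Matrix.smul_apply, smul_eq_mul] at e f g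
  have e22 := e 2 2
  have e23 := e 2 3
  have e32 := e 3 2
  have f00 := f 0 0
  have f22 := f 2 2
  have f33 := f 3 3
  have g00 := g 0 0
  have g22 := g 2 2
  have g33 := g 3 3
  clear e f g
  simp at e22 e23 e32 f00 f22 f33 g00 g22 g33
  have solve : ∀ m n : K, s * m + t * n = 0 → u * m + v * n = 0 → m = 0 ∧ n = 0 := by
    intro m n h1 h2
    constructor
    · exact (mul_eq_zero.1 (show (s * v - t * u) * m = 0 by
        linear_combination v * h1 - t * h2)).resolve_left hdet
    · exact (mul_eq_zero.1 (show (s * v - t * u) * n = 0 by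
        linear_combination s * h2 - u * h1)).resolve_left hdet
  obtain ⟨hx, hx'⟩ := solve x x' (by linear_combination -f00) (by linear_combination -g00)
  obtain ⟨hd, hd'⟩ := solve (a + d) (a' + d') (by linear_combination -f22 - f33)
    (by linear_combination -g22 - g33)
  obtain rfl : d = -a := by linear_combination hd
  obtain rfl : d' = -a' := by linear_combination hd'
  have hmat : ∀ r : K, a' = r * a → b' = r * b → c' = r * c → Y = r • X := by
    intro r h1 h2 h3
    rw [hYe, hXe, hx, hx', h1, h2, h3]
    ext i j
    fin_cases i <;> fin_cases j <;> simp
  by_cases h0 : a = 0 ∧ b = 0 ∧ c = 0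
  · left
    rw [hXe, hx, h0.1, h0.2.1, h0.2.2]
    ext i j
    fin_cases i <;> fin_cases j <;> simp
  · right
    obtain ⟨r, h1, h2, h3⟩ := exists_ratio (a := a) (b := b) (c := c) (a' := a') (b' := b')
      (c' := c') (by linear_combination e22)
      (mul_left_cancel₀ (two_ne_zero' K) (by linear_combination e23))
      (mul_left_cancel₀ (two_ne_zero' K) (by linear_combination -e32)) h0
    exact ⟨r, hmat r h1 h2 h3⟩

/-- As a commutator, `X` has zero scalar part and a traceless block. If the block were nonzero, its
centralizer in `gl(2)` would be spanned by it and the identity, hence commutative; but `Y` and `Z`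
lie there and their commutator is `X`. -/
theorem eq_zero_of_blocks {x a b c d x' a' b' c' d' x'' a'' b'' c'' d'' : K}
    {X Y Z : Matrix (Fin 4) (Fin 4) K}
    (hXe : X = !![x, 0, 0, 0; 0, x, 0, 0; 0, 0, a, b; 0, 0, c, d])
    (hYe : Y = !![x', 0, 0, 0; 0, x', 0, 0; 0, 0, a', b'; 0, 0, c', d'])
    (hZe : Z = !![x'', 0, 0, 0; 0, x'', 0, 0; 0, 0, a'', b''; 0, 0, c'', d''])
    (hXY : X * Y = Y * X) (hX : Z * X = X * Z) (hY : Z * Y - Y * Z = X) : X = 0 := by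
  have e := fun i j => congrFun (congrFun hXY i) j
  have f := fun i j => congrFun (congrFun hX i) j
  have g := fun i j => congrFun (congrFun hY i) j
  simp only [hXe, hYe, hZe, Matrix.mul_apply, Fin.sum_univ_four, Matrix.sub_apply] at e f g
  have e23 := e 2 3
  have e32 := e 3 2
  have f23 := f 2 3
  have f32 := f 3 2
  have g00 := g 0 0
  have g22 := g 2 2
  have g23 := g 2 3
  have g32 := g 3 2
  have g33 := g 3 3
  clear e f g
  simp at e23 e32 f23 f32 g00 g22 g23 g32 g33
  obtain rfl : x = 0 := by linear_combination -g00
  obtain rfl : d = -a := by linear_combination -g22 - g33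
  obtain rfl : a = 0 := by
    refine pow_eq_zero_iff (n := 3) (by norm_num) |>.1 (mul_left_cancel₀ (show (4 : K) ≠ 0 by norm_num) ?_)
    grind
  obtain rfl : b = 0 := by
    refine pow_eq_zero_iff (n := 2) (by norm_num) |>.1 ?_
    grind
  obtain rfl : c = 0 := by
    refine pow_eq_zero_iff (n := 2) (by norm_num) |>.1 ?_
    grind
  rw [hXe]
  ext i j
  fin_cases i <;> fin_cases j <;> simp

-- Schur's lemma for the sum of two copies of the standard module: the commutant is `gl(2)` acting
-- on the multiplicity space.
omit [CharZero K] in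
theorem commutant_two_two {X : Matrix (Fin 4) (Fin 4) K}
    (hE : !![0, 1, 0, 0; 0, 0, 0, 0; 0, 0, 0, 1; 0, 0, 0, 0] * X =
      X * !![0, 1, 0, 0; 0, 0, 0, 0; 0, 0, 0, 1; 0, 0, 0, 0])
    (hF : !![0, 0, 0, 0; 1, 0, 0, 0; 0, 0, 0, 0; 0, 0, 1, 0] * X =
      X * !![0, 0, 0, 0; 1, 0, 0, 0; 0, 0, 0, 0; 0, 0, 1, 0]) :
    ∃ a b c d, X = !![a, 0, b, 0; 0, a, 0, b; c, 0, d, 0; 0, c, 0, d] := by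
  have e := fun i j => congrFun (congrFun hE i) j
  have f := fun i j => congrFun (congrFun hF i) j
  simp [Fin.forall_fin_succ, Matrix.mul_apply, Fin.sum_univ_four] at e f
  refine ⟨X 0 0, X 0 2, X 2 0, X 2 2, ?_⟩
  ext i j
  fin_cases i <;> fin_cases j <;> simp <;> grind

theorem weight_two_of_two_two {A : Matrix (Fin 4) (Fin 4) K}
    (hA : !![1, 0, 0, 0; 0, -1, 0, 0; 0, 0, 1, 0; 0, 0, 0, -1] * A =
      A * !![1, 0, 0, 0; 0, -1, 0, 0; 0, 0, 1, 0; 0, 0, 0, -1] + (2 : K) • A) :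
    ∃ a b c d, A = !![0, a, 0, b; 0, 0, 0, 0; 0, c, 0, d; 0, 0, 0, 0] := by
  have hd : (!![1, 0, 0, 0; 0, -1, 0, 0; 0, 0, 1, 0; 0, 0, 0, -1] : Matrix (Fin 4) (Fin 4) K) =
      diagonal ![1, -1, 1, -1] := by ext i j; fin_cases i <;> fin_cases j <;> rfl
  rw [hd] at hA
  refine ⟨A 0 1, A 0 3, A 2 1, A 2 3, ?_⟩
  ext i j
  fin_cases i <;> fin_cases j <;> first | rfl | (exact Sl2Normal.apply_eq_zero hA (by simp <;> norm_num))

/-- On the multiplicity space `[Z, X] = pX` with `p ≠ 0` forces `X` and `X²` to have trace zero, and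
a `2 × 2` matrix with this property squares to zero. -/
theorem sq_eq_zero_of_two_two {a b c d a' b' c' d' p : K} {X Z : Matrix (Fin 4) (Fin 4) K}
    (hXe : X = !![a, 0, b, 0; 0, a, 0, b; c, 0, d, 0; 0, c, 0, d])
    (hZe : Z = !![a', 0, b', 0; 0, a', 0, b'; c', 0, d', 0; 0, c', 0, d'])
    (hX : Z * X - X * Z = p • X) (hp : p ≠ 0) : a + d = 0 ∧ a * a + b * c = 0 ∧ X * X = 0 := by
  have f := fun i j => congrFun (congrFun hX i) j
  simp only [hXe, hZe, Matrix.mul_apply, Fin.sum_univ_four, Matrix.sub_apply,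
    Matrix.smul_apply, smul_eq_mul] at f
  have f00 := f 0 0
  have f02 := f 0 2
  have f20 := f 2 0
  have f22 := f 2 2
  clear f
  simp at f00 f02 f20 f22
  have h1 : a + d = 0 := (mul_eq_zero.1 (show p * (a + d) = 0 by
    linear_combination -f00 - f22)).resolve_left hp
  obtain rfl : d = -a := by linear_combination h1
  have h2 : a * a + b * c = 0 := (mul_eq_zero.1 (show (2 * p) * (a * a + b * c) = 0 by
    linear_combination -2 * a * f00 - c * f02 - b * f20)).resolve_left (by simpa using hp)
  refine ⟨h1, h2, ?_⟩
  rw [hXe]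
  ext i j
  fin_cases i <;> fin_cases j <;> simp [Matrix.mul_apply, Fin.sum_univ_four] <;>
    first | ring1 | linear_combination h2

/-- In type 2+2 a weight-two matrix is `E` tensored with a `2 × 2` matrix `B`, and `[Z, B] = B`
makes `B` traceless. `X` is traceless and commutes with `B`, so `X = rB` if `B ≠ 0`; comparing the
`ad Z`-eigenvalues 1 and `p` gives `r = 0`. -/
theorem eq_zero_of_two_two {a b c d a' b' c' d' p x y z w : K} {A X Z : Matrix (Fin 4) (Fin 4) K}
    (hXe : X = !![a, 0, b, 0; 0, a, 0, b; c, 0, d, 0; 0, c, 0, d])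
    (hZe : Z = !![a', 0, b', 0; 0, a', 0, b'; c', 0, d', 0; 0, c', 0, d'])
    (hAe : A = !![0, x, 0, y; 0, 0, 0, 0; 0, z, 0, w; 0, 0, 0, 0])
    (hX : Z * X - X * Z = p • X) (hA : Z * A - A * Z = A) (hAX : A * X = X * A)
    (hp : p ≠ 0) (hp1 : p ≠ 1) : A = 0 ∨ X = 0 := by
  obtain ⟨hd, -, -⟩ := sq_eq_zero_of_two_two hXe hZe hX hp
  obtain rfl : d = -a := by linear_combination hd
  have e := fun i j => congrFun (congrFun hAX i) j
  have f := fun i j => congrFun (congrFun hX i) j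
  have g := fun i j => congrFun (congrFun hA i) j
  simp only [hXe, hZe, hAe, Matrix.mul_apply, Fin.sum_univ_four, Matrix.sub_apply,
    Matrix.smul_apply, smul_eq_mul] at e f g
  have e01 := e 0 1
  have e03 := e 0 3
  have e21 := e 2 1
  have f00 := f 0 0
  have f02 := f 0 2
  have f20 := f 2 0
  have g01 := g 0 1
  have g03 := g 0 3
  have g21 := g 2 1
  have g23 := g 2 3
  clear e f g
  simp at e01 e03 e21 f00 f02 f20 g01 g03 g21 g23
  obtain rfl : w = -x := by linear_combination -g01 - g23
  by_cases h0 : x = 0 ∧ y = 0 ∧ z = 0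
  · left
    rw [hAe, h0.1, h0.2.1, h0.2.2]
    ext i j
    fin_cases i <;> fin_cases j <;> simp
  · right
    obtain ⟨r, rfl, rfl, rfl⟩ := exists_ratio (a := x) (b := y) (c := z) (a' := a) (b' := b)
      (c' := c) (by linear_combination e01)
      (mul_left_cancel₀ (two_ne_zero' K) (by linear_combination e03))
      (mul_left_cancel₀ (two_ne_zero' K) (by linear_combination -e21)) h0
    have hr : r = 0 := by
      have h1 : (p - 1) * r * x = 0 := by linear_combination -f00 + r * g01
      have h2 : (p - 1) * r * y = 0 := by linear_combination -f02 + r * g03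
      have h3 : (p - 1) * r * z = 0 := by linear_combination -f20 + r * g21
      by_contra hr
      have : (p - 1) * r ≠ 0 := mul_ne_zero (sub_ne_zero.2 hp1) hr
      exact h0 ⟨(mul_eq_zero.1 h1).resolve_left this, (mul_eq_zero.1 h2).resolve_left this,
        (mul_eq_zero.1 h3).resolve_left this⟩
    rw [hXe, hr]
    ext i j
    fin_cases i <;> fin_cases j <;> simp

/-- The weight-two space is the line spanned by `E`. For `A = aE` the commutator of `A` with `[F,
A]` is a multiple of `E` by `2a²` up to sign. -/
theorem eq_zero_of_weight_two_two_one_one {A : Matrix (Fin 4) (Fin 4) K}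
    (hA : !![1, 0, 0, 0; 0, -1, 0, 0; 0, 0, 0, 0; 0, 0, 0, 0] * A =
      A * !![1, 0, 0, 0; 0, -1, 0, 0; 0, 0, 0, 0; 0, 0, 0, 0] + (2 : K) • A)
    (hcomm : A * (!![0, 0, 0, 0; 1, 0, 0, 0; 0, 0, 0, 0; 0, 0, 0, 0] * A -
        A * !![0, 0, 0, 0; 1, 0, 0, 0; 0, 0, 0, 0; 0, 0, 0, 0]) =
      (!![0, 0, 0, 0; 1, 0, 0, 0; 0, 0, 0, 0; 0, 0, 0, 0] * A -
        A * !![0, 0, 0, 0; 1, 0, 0, 0; 0, 0, 0, 0; 0, 0, 0, 0]) * A) : A = 0 := by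
  have hd : (!![1, 0, 0, 0; 0, -1, 0, 0; 0, 0, 0, 0; 0, 0, 0, 0] : Matrix (Fin 4) (Fin 4) K) =
      diagonal ![1, -1, 0, 0] := by ext i j; fin_cases i <;> fin_cases j <;> rfl
  rw [hd] at hA
  obtain ⟨a, rfl⟩ : ∃ a, A = !![0, a, 0, 0; 0, 0, 0, 0; 0, 0, 0, 0; 0, 0, 0, 0] := by
    refine ⟨A 0 1, ?_⟩
    ext i j
    fin_cases i <;> fin_cases j <;>
      first | rfl | (exact Sl2Normal.apply_eq_zero hA (by simp <;> norm_num))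
  have h01 := congrFun (congrFun hcomm 0) 1
  simp [Matrix.mul_apply, Fin.sum_univ_four] at h01
  have : a = 0 := by
    refine mul_self_eq_zero.1 (mul_left_cancel₀ (two_ne_zero' K) ?_)
    linear_combination h01
  rw [this]
  ext i j
  fin_cases i <;> fin_cases j <;> simp

/-- Types 4 and 3+1 are multiplicity free, so their commutants are diagonal and hence commutative.
-/
theorem Sl2Normal.commute_or {H E F X Z : Matrix (Fin 4) (Fin 4) K} (h : Sl2Normal H E F)
    (hHX : H * X = X * H) (hEX : E * X = X * E) (hHZ : H * Z = Z * H) (hEZ : E * Z = Z * E) :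
    Z * X = X * Z ∨ (H = !![1, 0, 0, 0; 0, -1, 0, 0; 0, 0, 1, 0; 0, 0, 0, -1] ∧
      E = !![0, 1, 0, 0; 0, 0, 0, 0; 0, 0, 0, 1; 0, 0, 0, 0] ∧
      F = !![0, 0, 0, 0; 1, 0, 0, 0; 0, 0, 0, 0; 0, 0, 1, 0]) ∨
      (H = !![1, 0, 0, 0; 0, -1, 0, 0; 0, 0, 0, 0; 0, 0, 0, 0] ∧
      E = !![0, 1, 0, 0; 0, 0, 0, 0; 0, 0, 0, 0; 0, 0, 0, 0] ∧
      F = !![0, 0, 0, 0; 1, 0, 0, 0; 0, 0, 0, 0; 0, 0, 0, 0]) := by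
  have hdiag : (∃ x, X = diagonal x) → (∃ z, Z = diagonal z) → Z * X = X * Z := by
    rintro ⟨x, rfl⟩ ⟨z, rfl⟩
    simp [mul_comm]
  cases h
  case two_two => exact .inr (.inl ⟨rfl, rfl, rfl⟩)
  case two_one_one => exact .inr (.inr ⟨rfl, rfl, rfl⟩)
  case four =>
    left
    have hd : (!![3, 0, 0, 0; 0, 1, 0, 0; 0, 0, -1, 0; 0, 0, 0, -3] : Matrix (Fin 4) (Fin 4) K) =
      diagonal ![3, 1, -1, -3] := by ext i j; fin_cases i <;> fin_cases j <;> rfl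
    rw [hd] at hHX hHZ
    have key : ∀ B : Matrix (Fin 4) (Fin 4) K,
        diagonal ![3, 1, -1, -3] * B = B * diagonal ![3, 1, -1, -3] → ∃ x, B = diagonal x := by
      intro B hB
      refine ⟨fun i => B i i, ?_⟩
      ext i j
      have hB' := hB.trans (by rw [zero_smul, add_zero] : _ = _ + (0 : K) • B)
      fin_cases i <;> fin_cases j <;>
        first | rfl | (exact Sl2Normal.apply_eq_zero hB' (by simp <;> norm_num))
    exact hdiag (key X hHX) (key Z hHZ)
  case three_one =>
    left
    have hd : (!![2, 0, 0, 0; 0, 0, 0, 0; 0, 0, -2, 0; 0, 0, 0, 0] : Matrix (Fin 4) (Fin 4) K) =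
      diagonal ![2, 0, -2, 0] := by ext i j; fin_cases i <;> fin_cases j <;> rfl
    rw [hd] at hHX hHZ
    have key : ∀ B : Matrix (Fin 4) (Fin 4) K,
        diagonal ![2, 0, -2, 0] * B = B * diagonal ![2, 0, -2, 0] →
        !![0, 2, 0, 0; 0, 0, 2, 0; 0, 0, 0, 0; 0, 0, 0, 0] * B =
          B * !![0, 2, 0, 0; 0, 0, 2, 0; 0, 0, 0, 0; 0, 0, 0, 0] → ∃ x, B = diagonal x := by
      intro B hB hB2
      refine ⟨fun i => B i i, ?_⟩
      -- The weight-zero space is two-dimensional here, so `H` alone does not make `B` diagonal;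
      -- commuting with `E` kills the two mixed entries.
      have h03 := congrFun (congrFun hB2 0) 3
      have h32 := congrFun (congrFun hB2 3) 2
      simp [Matrix.mul_apply, Fin.sum_univ_four] at h03 h32
      ext i j
      have hB' := hB.trans (by rw [zero_smul, add_zero] : _ = _ + (0 : K) • B)
      fin_cases i <;> fin_cases j <;> first | rfl | exact h03 | exact h32 |
        (exact Sl2Normal.apply_eq_zero hB' (by simp <;> norm_num))
    exact hdiag (key X hHX hEX) (key Z hHZ hEZ)

end

/-! ### Transfer to arbitrary `sl(2)`-triples -/

namespace Sl2Rel

variable {K : Type*} [Field K] [CharZero K] {H E F A X Y Z : Matrix (Fin 4) (Fin 4) K}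

theorem exists_normal (h : Sl2Rel H E F) (hH : H ≠ 0) :
    ∃ c : Matrix (Fin 4) (Fin 4) K ≃ₐ[K] Matrix (Fin 4) (Fin 4) K,
      Sl2Normal (c H) (c E) (c F) :=
  (h.classification hH).exists_algEquiv

theorem eq_zero_of_weight_three (h : Sl2Rel H E F) (hH : H ≠ 0)
    (hA : H * A = A * H + (3 : K) • A) : A = 0 := by
  obtain ⟨c, hc⟩ := h.exists_normal hH
  have := hc.eq_zero_of_weight_three (A := c A) (by simpa using congrArg c hA)
  simpa using this

theorem two_one_one_of_weight_one (h : Sl2Rel H E F) (hH : H ≠ 0)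
    (hA : H * A = A * H + (1 : K) • A) (h0 : A ≠ 0) :
    ∃ c : Matrix (Fin 4) (Fin 4) K ≃ₐ[K] Matrix (Fin 4) (Fin 4) K,
      c H = !![1, 0, 0, 0; 0, -1, 0, 0; 0, 0, 0, 0; 0, 0, 0, 0] ∧
      c E = !![0, 1, 0, 0; 0, 0, 0, 0; 0, 0, 0, 0; 0, 0, 0, 0] ∧
      c F = !![0, 0, 0, 0; 1, 0, 0, 0; 0, 0, 0, 0; 0, 0, 0, 0] := by
  obtain ⟨c, hc⟩ := h.exists_normal hH
  exact ⟨c, hc.eq_of_weight_one (A := c A) (by simpa using congrArg c hA) (by simpa using h0)⟩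

omit [CharZero K] in
theorem exists_blocks {c : Matrix (Fin 4) (Fin 4) K ≃ₐ[K] Matrix (Fin 4) (Fin 4) K}
    (cE : c E = !![0, 1, 0, 0; 0, 0, 0, 0; 0, 0, 0, 0; 0, 0, 0, 0])
    (cF : c F = !![0, 0, 0, 0; 1, 0, 0, 0; 0, 0, 0, 0; 0, 0, 0, 0])
    (hX : E * X = X * E ∧ F * X = X * F) :
    ∃ x a b d e, c X = !![x, 0, 0, 0; 0, x, 0, 0; 0, 0, a, b; 0, 0, d, e] :=
  commutant_two_one_one (by simpa [cE] using congrArg c hX.1) (by simpa [cF] using congrArg c hX.2)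

/-- If the module `gl(4)` has a vector of weight one, then a two-dimensional abelian subalgebra of
the commutant of `sl(2)` has no invertible derivation induced by the commutant. -/
theorem dependent (h : Sl2Rel H E F) (hH : H ≠ 0) (hA : H * A = A * H + (1 : K) • A) (h0 : A ≠ 0)
    (hX : E * X = X * E ∧ F * X = X * F) (hY : E * Y = Y * E ∧ F * Y = Y * F)
    (hZ : E * Z = Z * E ∧ F * Z = Z * F) (hXY : X * Y = Y * X) {s t u v : K}
    (hZX : Z * X - X * Z = s • X + t • Y) (hZY : Z * Y - Y * Z = u • X + v • Y)
    (hdet : s * v - t * u ≠ 0) : X = 0 ∨ ∃ r : K, Y = r • X := by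
  obtain ⟨c, -, cE, cF⟩ := h.two_one_one_of_weight_one hH hA h0
  obtain ⟨_, _, _, _, _, cX⟩ := exists_blocks cE cF hX
  obtain ⟨_, _, _, _, _, cY⟩ := exists_blocks cE cF hY
  obtain ⟨_, _, _, _, _, cZ⟩ := exists_blocks cE cF hZ
  rcases dependent_blocks cX cY cZ (by simpa only [map_mul] using congrArg c hXY)
    (by simpa only [map_mul, map_sub, map_add, map_smul] using congrArg c hZX)
    (by simpa only [map_mul, map_sub, map_add, map_smul] using congrArg c hZY) hdet with h1 | ⟨r, h1⟩
  · exact .inl (by simpa using h1)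
  · exact .inr ⟨r, c.injective (by simpa using h1)⟩

/-- Covers the degenerate case in which `ad Z` acts on the plane of `X` and `Y` by a nilpotent
Jordan block, so that the determinant condition of `dependent` fails. -/
theorem eq_zero_of_jordan (h : Sl2Rel H E F) (hH : H ≠ 0) (hA : H * A = A * H + (1 : K) • A)
    (h0 : A ≠ 0) (hX : E * X = X * E ∧ F * X = X * F) (hY : E * Y = Y * E ∧ F * Y = Y * F)
    (hZ : E * Z = Z * E ∧ F * Z = Z * F) (hXY : X * Y = Y * X)
    (hZX : Z * X = X * Z) (hZY : Z * Y - Y * Z = X) : X = 0 := by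
  obtain ⟨c, -, cE, cF⟩ := h.two_one_one_of_weight_one hH hA h0
  obtain ⟨_, _, _, _, _, cX⟩ := exists_blocks cE cF hX
  obtain ⟨_, _, _, _, _, cY⟩ := exists_blocks cE cF hY
  obtain ⟨_, _, _, _, _, cZ⟩ := exists_blocks cE cF hZ
  simpa using eq_zero_of_blocks cX cY cZ (by simpa only [map_mul] using congrArg c hXY)
    (by simpa only [map_mul] using congrArg c hZX)
    (by simpa only [map_mul, map_sub] using congrArg c hZY)

theorem eq_zero_of_weight_two (h : Sl2Rel H E F) (hH : H ≠ 0)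
    (hX : H * X = X * H + (1 : K) • X) (h0 : X ≠ 0) (hA : H * A = A * H + (2 : K) • A)
    (hcomm : A * (F * A - A * F) = (F * A - A * F) * A) : A = 0 := by
  obtain ⟨c, cH, cE, cF⟩ := h.two_one_one_of_weight_one hH hX h0
  simpa using eq_zero_of_weight_two_two_one_one (A := c A) (by simpa [cH] using congrArg c hA)
    (by simpa only [map_mul, map_sub, cF] using congrArg c hcomm)

/-- A vector `A` of weight two in `gl(4)` spanning an abelian submodule, and commuting elements
`X`, `Z` of the commutant with `[Z, X] = p X`: then `H² = 1`, `X² = 0` unless `A` or `X` is zero. -/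
theorem weight_two_or (h : Sl2Rel H E F) (hH : H ≠ 0) (hA : H * A = A * H + (2 : K) • A)
    (hcomm : A * (F * A - A * F) = (F * A - A * F) * A) (hHX : H * X = X * H)
    (hX : E * X = X * E ∧ F * X = X * F) (hHZ : H * Z = Z * H)
    (hZ : E * Z = Z * E ∧ F * Z = Z * F) {p : K} (hp : p ≠ 0) (hZX : Z * X - X * Z = p • X)
    (hZA : Z * A - A * Z = A) (hAX : A * X = X * A) :
    A = 0 ∨ X = 0 ∨ (E * E = 0 ∧ X * X = 0 ∧ p = 1) := by
  obtain ⟨c, hc⟩ := h.exists_normal hH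
  rcases hc.commute_or (by simpa using congrArg c hHX) (by simpa using congrArg c hX.1)
    (by simpa using congrArg c hHZ) (by simpa using congrArg c hZ.1) with
    h1 | ⟨cH, cE, cF⟩ | ⟨cH, cE, cF⟩
  · right; left
    have h2 : Z * X = X * Z := c.injective (by simpa using h1)
    rw [h2, sub_self] at hZX
    exact (smul_eq_zero.1 hZX.symm).resolve_left hp
  · have cZX : c Z * c X - c X * c Z = p • c X := by
      simpa only [map_mul, map_sub, map_smul] using congrArg c hZX
    obtain ⟨_, _, _, _, cX⟩ := commutant_two_two (X := c X) (by simpa [cE] using congrArg c hX.1)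
      (by simpa [cF] using congrArg c hX.2)
    obtain ⟨_, _, _, _, cZ⟩ := commutant_two_two (X := c Z) (by simpa [cE] using congrArg c hZ.1)
      (by simpa [cF] using congrArg c hZ.2)
    obtain ⟨_, _, _, _, cA⟩ := weight_two_of_two_two (A := c A) (by simpa [cH] using congrArg c hA)
    by_cases hp1 : p = 1
    · refine .inr (.inr ⟨?_, ?_, hp1⟩)
      · apply c.injective
        rw [map_mul, cE, map_zero]
        ext i j
        fin_cases i <;> fin_cases j <;> simp [Matrix.mul_apply, Fin.sum_univ_four]
      · exact c.injective (by simpa using (sq_eq_zero_of_two_two cX cZ cZX hp).2.2)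
    · rcases eq_zero_of_two_two cX cZ cA cZX (by simpa only [map_mul, map_sub] using congrArg c hZA)
        (by simpa only [map_mul] using congrArg c hAX) hp hp1 with h1 | h1
      · exact .inl (by simpa using h1)
      · exact .inr (.inl (by simpa using h1))
  · left
    simpa using eq_zero_of_weight_two_two_one_one (A := c A) (by simpa [cH] using congrArg c hA)
      (by simpa only [map_mul, map_sub, cF] using congrArg c hcomm)

end Sl2Rel

/-! ### Real four-dimensional representations of `so(3)` -/

/-- Commutation relations of the standard basis of `so(3)`, for real `4 × 4` matrices. -/
structure So3Rel (X Y Z : Matrix (Fin 4) (Fin 4) ℝ) : Prop where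
  xy : X * Y - Y * X = Z
  yz : Y * Z - Z * Y = X
  zx : Z * X - X * Z = Y

namespace So3Rel

variable {X Y Z A B : Matrix (Fin 4) (Fin 4) ℝ}

/-- Complexification of real matrices. -/
noncomputable def toC : Matrix (Fin 4) (Fin 4) ℝ →+* Matrix (Fin 4) (Fin 4) ℂ :=
  Complex.ofRealHom.mapMatrix

theorem toC_smul (r : ℝ) (M : Matrix (Fin 4) (Fin 4) ℝ) : toC (r • M) = (r : ℂ) • toC M := by
  ext i j; simp [toC]

theorem toC_add_I_smul_eq_zero {M N : Matrix (Fin 4) (Fin 4) ℝ}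
    (h : toC M + Complex.I • toC N = 0) : M = 0 ∧ N = 0 := by
  have : ∀ i j, M i j = 0 ∧ N i j = 0 := fun i j => by
    have := congrFun (congrFun h i) j
    simpa [toC, Complex.ext_iff] using this
  exact ⟨Matrix.ext fun i j => (this i j).1, Matrix.ext fun i j => (this i j).2⟩

theorem toC_injective : Function.Injective toC := fun M N h => by
  have h1 : toC (M - N) + Complex.I • toC 0 = 0 := by simp [h]
  exact sub_eq_zero.1 (toC_add_I_smul_eq_zero h1).1

theorem sl2Rel (h : So3Rel X Y Z) : Sl2Rel ((2 * Complex.I) • toC Z)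
    (toC X + Complex.I • toC Y) (-toC X + Complex.I • toC Y) := by
  have xy : toC X * toC Y - toC Y * toC X = toC Z := by simp only [← map_mul, ← map_sub, h.xy]
  have yz : toC Y * toC Z - toC Z * toC Y = toC X := by simp only [← map_mul, ← map_sub, h.yz]
  have zx : toC Z * toC X - toC X * toC Z = toC Y := by simp only [← map_mul, ← map_sub, h.zx]
  have hI : Complex.I * Complex.I = -1 := Complex.I_mul_I
  rw [sub_eq_iff_eq_add] at xy yz zx
  constructor
  · simp only [Matrix.mul_add, Matrix.add_mul, Matrix.smul_mul, Matrix.mul_smul, smul_smul, zx, yz,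
      smul_add]
    match_scalars <;> first | ring1 | linear_combination 2 * hI | linear_combination -2 * hI
  · simp only [Matrix.mul_add, Matrix.add_mul, Matrix.smul_mul, Matrix.mul_smul, smul_smul, zx, yz,
      smul_add, Matrix.mul_neg, Matrix.neg_mul]
    match_scalars <;> first | ring1 | linear_combination 2 * hI | linear_combination -2 * hI
  · simp only [Matrix.mul_add, Matrix.add_mul, Matrix.smul_mul, Matrix.mul_smul, smul_smul, xy,
      smul_add, Matrix.mul_neg, Matrix.neg_mul]
    module

/-- The two identities are the real and imaginary parts of `(X + iY)² = 0`. -/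
theorem quaternion
    (hE : (toC X + Complex.I • toC Y) * (toC X + Complex.I • toC Y) = 0) :
    X * X = Y * Y ∧ X * Y = -(Y * X) := by
  have h1 : toC (X * X - Y * Y) + Complex.I • toC (X * Y + Y * X) = 0 := by
    rw [← hE]
    simp only [map_sub, map_add, map_mul, Matrix.mul_add, Matrix.add_mul, Matrix.smul_mul,
      Matrix.mul_smul]
    match_scalars <;> first | ring1 | linear_combination Complex.I_sq |
      linear_combination -Complex.I_sq
  obtain ⟨h2, h3⟩ := toC_add_I_smul_eq_zero h1
  exact ⟨sub_eq_zero.1 h2, eq_neg_of_add_eq_zero_left h3⟩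

/-- Anticommuting matrices have products equal to half their commutators, so `2X, 2Y, 2Z` multiply
like the imaginary quaternion units, apart from the common value of their squares. -/
theorem products (h : So3Rel X Y Z) (hq : X * X = Y * Y ∧ X * Y = -(Y * X)) :
    (X * Y = (1 / 2 : ℝ) • Z ∧ Y * X = -(1 / 2 : ℝ) • Z) ∧
    (Y * Z = (1 / 2 : ℝ) • X ∧ Z * Y = -(1 / 2 : ℝ) • X) ∧
    (Z * X = (1 / 2 : ℝ) • Y ∧ X * Z = -(1 / 2 : ℝ) • Y) ∧ Z * Z = Y * Y := by
  have half : ∀ P Q R : Matrix (Fin 4) (Fin 4) ℝ, P - Q = R → P = -Q →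
      P = (1 / 2 : ℝ) • R ∧ Q = -(1 / 2 : ℝ) • R := by
    rintro P Q R rfl rfl
    constructor <;> module
  have h1 := half _ _ _ h.xy hq.2
  have hZ : Z = (2 : ℝ) • (X * Y) := by rw [h1.1]; module
  have h2 := half _ _ _ h.yz (by
    rw [hZ, Matrix.mul_smul, Matrix.smul_mul, ← Matrix.mul_assoc, hq.2, neg_mul, smul_neg, neg_neg])
  have h3 := half _ _ _ h.zx (by
    rw [hZ, Matrix.mul_smul, Matrix.smul_mul, Matrix.mul_assoc, hq.2, mul_neg, smul_neg, neg_neg])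
  refine ⟨h1, h2, h3, ?_⟩
  nth_rw 2 [hZ]
  rw [Matrix.mul_smul, ← Matrix.mul_assoc, h3.1, Matrix.smul_mul]
  module

theorem linearIndependent (h : So3Rel X Y Z) (hq : X * X = Y * Y ∧ X * Y = -(Y * X))
    {w : Fin 4 → ℝ} (hw : w ≠ 0) (hY : Y *ᵥ (Y *ᵥ w) = -(1 / 4 : ℝ) • w) :
    LinearIndependent ℝ ![w, X *ᵥ w, Y *ᵥ w, Z *ᵥ w] := by
  obtain ⟨⟨xy, yx⟩, ⟨yz, zy⟩, ⟨zx, xz⟩, zz⟩ := h.products hq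
  rw [Fintype.linearIndependent_iff]
  intro g hg
  simp only [Fin.sum_univ_four, Matrix.cons_val] at hg
  -- Multiplying by the conjugate quaternion turns the linear relation into the norm of `g` times
  -- `w`. Positivity of the norm over `ℝ` is what forces `g = 0`.
  have h1 := congrArg (fun v => g 0 • v - g 1 • X *ᵥ v - g 2 • Y *ᵥ v - g 3 • Z *ᵥ v) hg
  rw [Matrix.mulVec_mulVec] at hY
  simp only [Matrix.mulVec_add, Matrix.mulVec_smul, Matrix.mulVec_mulVec, hq.1, xy, yx, yz, zy, zx,
    xz, zz, hY, Matrix.smul_mulVec, Matrix.mulVec_zero, smul_zero, sub_zero] at h1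
  have h2 : (g 0 ^ 2 + (g 1 ^ 2 + g 2 ^ 2 + g 3 ^ 2) / 4) • w = 0 := by
    rw [← h1]; module
  have h3 := (smul_eq_zero.1 h2).resolve_right hw
  have hn : ∀ i, 0 ≤ g i ^ 2 := fun i => sq_nonneg _
  have g0 : g 0 = 0 := (pow_eq_zero_iff two_ne_zero).1 (by linarith [hn 0, hn 1, hn 2, hn 3])
  have g1 : g 1 = 0 := (pow_eq_zero_iff two_ne_zero).1 (by linarith [hn 0, hn 1, hn 2, hn 3])
  have g2 : g 2 = 0 := (pow_eq_zero_iff two_ne_zero).1 (by linarith [hn 0, hn 1, hn 2, hn 3])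
  have g3 : g 3 = 0 := (pow_eq_zero_iff two_ne_zero).1 (by linarith [hn 0, hn 1, hn 2, hn 3])
  simp [Fin.forall_fin_succ, g0, g1, g2, g3]

theorem eq_zero_of_mulVec (h : So3Rel X Y Z) (hq : X * X = Y * Y ∧ X * Y = -(Y * X))
    {w : Fin 4 → ℝ} (hw : w ≠ 0) (hY : Y *ᵥ (Y *ᵥ w) = -(1 / 4 : ℝ) • w) (h0 : A *ᵥ w = 0)
    (hAX : A *ᵥ (X *ᵥ w) = 0) (hAY : A *ᵥ (Y *ᵥ w) = 0) (hAZ : A *ᵥ (Z *ᵥ w) = 0) : A = 0 := by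
  have hu := exists_isUnit_of_linearIndependent (h.linearIndependent hq hw hY)
  refine hu.mul_left_eq_zero.1 ?_
  rw [mul_of_transpose_eq (B := 0), Matrix.mul_zero]
  simp [-Matrix.mulVec_mulVec, Fin.forall_fin_succ, h0, hAX, hAY, hAZ]

/-- `Y²` acts as `-1/4` on the images of `X, Y, Z`. For a nonzero `w = Zu`, the vectors `w, Xw, Yw,
Zw` lie in these images and span `ℝ⁴`. -/
theorem sq_eq (h : So3Rel X Y Z) (hq : X * X = Y * Y ∧ X * Y = -(Y * X)) (hZ : Z ≠ 0) :
    Y * Y = -(1 / 4 : ℝ) • (1 : Matrix (Fin 4) (Fin 4) ℝ) := by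
  obtain ⟨⟨xy, yx⟩, ⟨yz, zy⟩, ⟨zx, xz⟩, zz⟩ := h.products hq
  have e1 : Y * Y * X = -(1 / 4 : ℝ) • X := by
    rw [Matrix.mul_assoc, yx, Matrix.mul_smul, yz]; module
  have e2 : Y * Y * Y = -(1 / 4 : ℝ) • Y := by
    rw [← hq.1, Matrix.mul_assoc, xy, Matrix.mul_smul, xz]; module
  have e3 : Y * Y * Z = -(1 / 4 : ℝ) • Z := by
    rw [Matrix.mul_assoc, yz, Matrix.mul_smul, yx]; module
  obtain ⟨u, hu⟩ := exists_mulVec_ne_zero hZ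
  have hw : Y *ᵥ (Y *ᵥ (Z *ᵥ u)) = -(1 / 4 : ℝ) • (Z *ᵥ u) := by
    simp only [Matrix.mulVec_mulVec, ← Matrix.mul_assoc, e3, Matrix.smul_mulVec]
  have key : ∀ M : Matrix (Fin 4) (Fin 4) ℝ, Y * Y * M = -(1 / 4 : ℝ) • M →
      ∀ v, (Y * Y - -(1 / 4 : ℝ) • (1 : Matrix (Fin 4) (Fin 4) ℝ)) *ᵥ (M *ᵥ v) = 0 := by
    intro M hM v
    rw [Matrix.mulVec_mulVec, Matrix.sub_mul, hM, Matrix.smul_mul, Matrix.one_mul, sub_self,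
      Matrix.zero_mulVec]
  exact sub_eq_zero.1 (h.eq_zero_of_mulVec hq hu hw (key Z e3 u) (key X e1 _) (key Y e2 _)
    (key Z e3 _))

/-- A nonzero vector `Au` generates all of `ℝ⁴` under the quaternions, and `A` kills `Au` and
commutes with the generators. -/
theorem eq_zero_of_commute (h : So3Rel X Y Z) (hq : X * X = Y * Y ∧ X * Y = -(Y * X)) (hZ : Z ≠ 0)
    (hX : A * X = X * A) (hY : A * Y = Y * A) (hAZ : A * Z = Z * A) (hA : A * A = 0) : A = 0 := by
  by_contra h0
  obtain ⟨u, hu⟩ := exists_mulVec_ne_zero h0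
  have key : ∀ M : Matrix (Fin 4) (Fin 4) ℝ, A * M = M * A → A *ᵥ (M *ᵥ (A *ᵥ u)) = 0 := by
    intro M hM
    rw [Matrix.mulVec_mulVec, hM, Matrix.mulVec_mulVec, Matrix.mul_assoc, hA, Matrix.mul_zero,
      Matrix.zero_mulVec]
  refine h0 (h.eq_zero_of_mulVec hq hu ?_ ?_ (key X hX) (key Y hY) (key Z hAZ))
  · rw [Matrix.mulVec_mulVec, h.sq_eq hq hZ, Matrix.smul_mulVec, Matrix.one_mulVec]
  · rw [Matrix.mulVec_mulVec, hA, Matrix.zero_mulVec]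

theorem H_ne_zero (hZ : Z ≠ 0) : (2 * Complex.I) • toC Z ≠ 0 := by
  refine smul_ne_zero (by simp) fun h => hZ (toC_injective ?_)
  rw [h, map_zero]

/-- The spin representation of `so(3)` does not occur in `gl(4, ℝ)`. -/
theorem eq_zero_of_weight_one (h : So3Rel X Y Z) (hZ : Z ≠ 0) {A : Matrix (Fin 4) (Fin 4) ℂ}
    (hA : ((2 * Complex.I) • toC Z) * A = A * ((2 * Complex.I) • toC Z) + (1 : ℂ) • A) : A = 0 := by
  by_contra h0
  -- Weight one forces type 2+1+1, where `H` has a kernel. There `E² = 0`, so the quaternion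
  -- relations give `H² = 1`, contradicting the `(2, 2)` entry.
  obtain ⟨c, cH, cE, -⟩ := h.sl2Rel.two_one_one_of_weight_one (H_ne_zero hZ) hA h0
  have hE := quaternion <| c.injective <| by
    rw [map_mul, cE, map_zero]
    ext i j
    fin_cases i <;> fin_cases j <;> simp [Matrix.mul_apply, Fin.sum_univ_four]
  have hH : ((2 * Complex.I) • toC Z) * ((2 * Complex.I) • toC Z) = 1 := by
    rw [Matrix.smul_mul, Matrix.mul_smul, ← map_mul, (h.products hE).2.2.2, h.sq_eq hE hZ, toC_smul,
      map_one, smul_smul, smul_smul]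
    have : 2 * Complex.I * (2 * Complex.I) * ((-(1 / 4) : ℝ) : ℂ) = 1 := by
      push_cast
      linear_combination -Complex.I_sq
    rw [this, one_smul]
  have h22 := congrFun (congrFun (congrArg c hH) 2) 2
  rw [map_mul, cH, map_one] at h22
  simp [Matrix.mul_apply, Fin.sum_univ_four] at h22

/-- `A + iB` is an eigenvector of `ad Z` for `-i/2`, so it has weight one for `H = 2iZ`. -/
theorem eq_zero_of_R4 (h : So3Rel X Y Z) (hZ : Z ≠ 0) (hA : Z * A = A * Z + (1 / 2 : ℝ) • B)
    (hB : Z * B = B * Z - (1 / 2 : ℝ) • A) : A = 0 := by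
  have hA' : toC Z * toC A = toC A * toC Z + (1 / 2 : ℂ) • toC B := by
    simpa [toC_smul] using congrArg toC hA
  have hB' : toC Z * toC B = toC B * toC Z - (1 / 2 : ℂ) • toC A := by
    simpa [toC_smul] using congrArg toC hB
  refine (toC_add_I_smul_eq_zero (h.eq_zero_of_weight_one hZ (A := toC A + Complex.I • toC B) ?_)).1
  simp only [Matrix.mul_add, Matrix.add_mul, Matrix.smul_mul, Matrix.mul_smul, smul_smul, smul_add,
    smul_sub, hA', hB']
  match_scalars <;> first | ring1 | linear_combination Complex.I_sq |
    linear_combination -Complex.I_sq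

/-- `A + iB` is a highest weight vector of weight two in the complexified module, so `weight_two_or`
applies with `D` and `S` as elements of the commutant. -/
theorem eq_zero_of_R3 (h : So3Rel X Y Z) (hZ : Z ≠ 0) {C D S : Matrix (Fin 4) (Fin 4) ℝ}
    (zA : Z * A = A * Z + B) (zB : Z * B = B * Z - A) (xA : X * A = A * X) (xB : X * B = B * X + C)
    (yA : Y * A = A * Y - C) (yB : Y * B = B * Y) (hAC : A * C = C * A) (hBC : B * C = C * B)
    (hX : X * D = D * X ∧ X * S = S * X) (hY : Y * D = D * Y ∧ Y * S = S * Y)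
    (hZD : Z * D = D * Z ∧ Z * S = S * Z) (hAD : A * D = D * A) (hBD : B * D = D * B)
    (hSA : S * A - A * S = A) (hSB : S * B - B * S = B) {p : ℝ} (hp : p ≠ 0)
    (hSD : S * D - D * S = p • D) : A = 0 ∨ D = 0 := by
  have lift : ∀ {P Q : Matrix (Fin 4) (Fin 4) ℝ}, P * Q = Q * P → toC P * toC Q = toC Q * toC P :=
    fun hPQ => by rw [← map_mul, hPQ, map_mul]
  have zA' : toC Z * toC A = toC A * toC Z + toC B := by simpa using congrArg toC zA
  have zB' : toC Z * toC B = toC B * toC Z - toC A := by simpa using congrArg toC zB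
  have xB' : toC X * toC B = toC B * toC X + toC C := by simpa using congrArg toC xB
  have yA' : toC Y * toC A = toC A * toC Y - toC C := by simpa using congrArg toC yA
  have hF : (-toC X + Complex.I • toC Y) * (toC A + Complex.I • toC B) -
      (toC A + Complex.I • toC B) * (-toC X + Complex.I • toC Y) = (-2 * Complex.I) • toC C := by
    simp only [Matrix.mul_add, Matrix.add_mul, Matrix.smul_mul, Matrix.mul_smul, smul_smul,
      Matrix.mul_neg, Matrix.neg_mul, lift xA, lift yB, xB', yA', smul_add, smul_sub]
    module
  have main : toC A + Complex.I • toC B = 0 ∨ toC D = 0 ∨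
      (toC X + Complex.I • toC Y) * (toC X + Complex.I • toC Y) = 0 ∧ toC D * toC D = 0 ∧
        (p : ℂ) = 1 := by
    refine h.sl2Rel.weight_two_or (H_ne_zero hZ) (Z := toC S) ?_ ?_ ?_ ⟨?_, ?_⟩ ?_ ⟨?_, ?_⟩
      (by exact_mod_cast hp) ?_ ?_ ?_
    · simp only [Matrix.mul_add, Matrix.add_mul, Matrix.smul_mul, Matrix.mul_smul, smul_smul, smul_add,
        smul_sub, zA', zB']
      match_scalars <;> first | ring1 | linear_combination 2 * Complex.I_sq |
        linear_combination -2 * Complex.I_sq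
    · rw [hF]
      simp only [Matrix.add_mul, Matrix.mul_add, Matrix.smul_mul, Matrix.mul_smul, lift hAC, lift hBC]
      module
    · rw [Matrix.smul_mul, Matrix.mul_smul, lift hZD.1]
    · simp only [Matrix.add_mul, Matrix.mul_add, Matrix.smul_mul, Matrix.mul_smul, lift hX.1,
        lift hY.1]
    · simp only [Matrix.add_mul, Matrix.mul_add, Matrix.smul_mul, Matrix.mul_smul, Matrix.neg_mul,
        Matrix.mul_neg, lift hX.1, lift hY.1]
    · rw [Matrix.smul_mul, Matrix.mul_smul, lift hZD.2]
    · simp only [Matrix.add_mul, Matrix.mul_add, Matrix.smul_mul, Matrix.mul_smul, lift hX.2,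
        lift hY.2]
    · simp only [Matrix.add_mul, Matrix.mul_add, Matrix.smul_mul, Matrix.mul_smul, Matrix.neg_mul,
        Matrix.mul_neg, lift hX.2, lift hY.2]
    · rw [← map_mul, ← map_mul, ← map_sub, hSD, toC_smul]
    · have h1 : toC S * toC A = toC A * toC S + toC A := by
        simpa using congrArg toC (sub_eq_iff_eq_add'.1 hSA)
      have h2 : toC S * toC B = toC B * toC S + toC B := by
        simpa using congrArg toC (sub_eq_iff_eq_add'.1 hSB)
      simp only [Matrix.add_mul, Matrix.mul_add, Matrix.smul_mul, Matrix.mul_smul, h1, h2]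
      module
    · simp only [Matrix.add_mul, Matrix.mul_add, Matrix.smul_mul, Matrix.mul_smul, lift hAD, lift hBD]
  rcases main with h1 | h1 | ⟨h1, h2, -⟩
  · exact .inl (toC_add_I_smul_eq_zero h1).1
  · exact .inr (toC_injective (by rw [h1, map_zero]))
  -- The exceptional case `p = 1` of type 2+2 does occur over `ℂ`; the real structure excludes it,
  -- because `D` would be a square-zero matrix commuting with the quaternions.
  · refine .inr (h.eq_zero_of_commute (quaternion h1) hZ hX.1.symm hY.1.symm hZD.1.symm ?_)
    exact toC_injective (by rw [map_mul, h2, map_zero])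

end So3Rel

/-! ### Reduction of `mu` to matrices of size four and five -/

/-- A faithful representation of any dimension below five becomes one of dimension exactly four by
adding a zero block, so a single size has to be excluded. -/
theorem mu_eq_five {S : Levi8.LieTable}
    (lower : ∀ φ : (Fin 8 → ℝ) →ₗ[ℝ] Matrix (Fin 4) (Fin 4) ℝ, Function.Injective φ →
      (∀ x y, φ (S.table.bracket x y) = φ x * φ y - φ y * φ x) → False)
    (M : (Fin 8 → ℝ) → Matrix (Fin 5) (Fin 5) ℝ) (hadd : ∀ x y, M (x + y) = M x + M y)
    (hsmul : ∀ (r : ℝ) x, M (r • x) = r • M x)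
    (hlie : ∀ x y z : Fin 8 → ℝ, (∀ i, z i = S.table.bracket x y i) → M z = M x * M y - M y * M x)
    (hinj : ∀ x : Fin 8 → ℝ, M x = 0 → ∀ i, x i = 0) : mu S.Alg = 5 := by
  have h5 : 5 ∈ {n : ℕ | ∃ φ : S.Alg →ₗ⁅ℝ⁆ Matrix (Fin n) (Fin n) ℝ, Function.Injective φ} := by
    let f : S.Alg →ₗ[ℝ] Matrix (Fin 5) (Fin 5) ℝ :=
      { toFun := M, map_add' := hadd, map_smul' := hsmul }
    refine ⟨{ f with map_lie' := fun {x y} => hlie x y _ fun _ => rfl }, ?_⟩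
    refine (injective_iff_map_eq_zero f).2 fun x hx => funext fun i => hinj x hx i
  refine le_antisymm (Nat.sInf_le h5) (le_csInf ⟨5, h5⟩ ?_)
  rintro n ⟨φ, hφ⟩
  by_contra! hn
  obtain ⟨m, hm⟩ : ∃ m, n + m = 4 := ⟨4 - n, by omega⟩
  let e : Fin n ⊕ Fin m ≃ Fin 4 := finSumFinEquiv.trans (finCongr hm)
  let ψ : (Fin 8 → ℝ) →ₗ[ℝ] Matrix (Fin 4) (Fin 4) ℝ :=
    { toFun := fun x => Matrix.reindex e e (Matrix.fromBlocks (φ x) 0 0 0)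
      map_add' := fun x y => by
        rw [show φ (x + y) = φ x + φ y from map_add φ x y]
        ext i j
        simp only [Matrix.reindex_apply, Matrix.submatrix_apply, Matrix.add_apply]
        rcases e.symm i with a | a <;> rcases e.symm j with b | b <;> simp
      map_smul' := fun r x => by
        rw [show φ (r • x) = r • φ x from map_smul φ r x]
        ext i j
        simp only [Matrix.reindex_apply, Matrix.submatrix_apply, Matrix.smul_apply, RingHom.id_apply]
        rcases e.symm i with a | a <;> rcases e.symm j with b | b <;> simp }
  refine lower ψ ?_ ?_
  · intro x y hxy
    apply hφ
    have h1 : Matrix.reindex e e (Matrix.fromBlocks (φ x) 0 0 0) =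
      Matrix.reindex e e (Matrix.fromBlocks (φ y) 0 0 0) := hxy
    exact (Matrix.fromBlocks_inj.1 ((Matrix.reindex e e).injective h1)).1
  · intro (x : S.Alg) (y : S.Alg)
    change Matrix.reindex e e (Matrix.fromBlocks (φ ⁅x, y⁆) 0 0 0) =
      Matrix.reindex e e (Matrix.fromBlocks (φ x) 0 0 0) *
        Matrix.reindex e e (Matrix.fromBlocks (φ y) 0 0 0) -
        Matrix.reindex e e (Matrix.fromBlocks (φ y) 0 0 0) *
        Matrix.reindex e e (Matrix.fromBlocks (φ x) 0 0 0)
    rw [LieHom.map_lie, LieRing.of_associative_ring_bracket]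
    simp only [Matrix.reindex_apply, Matrix.submatrix_mul_equiv, Matrix.fromBlocks_multiply]
    ext i j
    simp only [Matrix.submatrix_apply, Matrix.sub_apply]
    rcases e.symm i with a | a <;> rcases e.symm j with b | b <;> simp

/-! ### Matrix relations read off from the bracket tables -/

namespace Levi8

variable {T : Table} {φ : (Fin 8 → ℝ) →ₗ[ℝ] Matrix (Fin 4) (Fin 4) ℝ}

theorem e_ne_zero (i : Fin 8) : e i ≠ 0 := fun h => by
  simpa [e_apply] using congrFun h i

theorem mul_eq (hφ : ∀ x y, φ (T.bracket x y) = φ x * φ y - φ y * φ x) {i j : Fin 8}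
    {v : Fin 8 → ℝ} (h : T.bracket (e i) (e j) = v) : φ (e i) * φ (e j) = φ (e j) * φ (e i) + φ v := by
  rw [← h, hφ]
  abel

theorem commute_of_bracket_eq_zero (hφ : ∀ x y, φ (T.bracket x y) = φ x * φ y - φ y * φ x)
    {i j : Fin 8} (h : T.bracket (e i) (e j) = 0) : φ (e i) * φ (e j) = φ (e j) * φ (e i) := by
  rw [mul_eq hφ h, map_zero, add_zero]

theorem sl2Rel_of_table (hφ : ∀ x y, φ (T.bracket x y) = φ x * φ y - φ y * φ x)
    (h01 : T.bracket (e 0) (e 1) = (2 : ℝ) • e 1) (h02 : T.bracket (e 0) (e 2) = (-2 : ℝ) • e 2)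
    (h12 : T.bracket (e 1) (e 2) = e 0) : Sl2Rel (φ (e 0)) (φ (e 1)) (φ (e 2)) where
  hE := by rw [mul_eq hφ h01, map_smul]
  hF := by rw [mul_eq hφ h02, map_smul]; module
  eF := mul_eq hφ h12

theorem so3Rel_of_table (hφ : ∀ x y, φ (T.bracket x y) = φ x * φ y - φ y * φ x)
    (h01 : T.bracket (e 0) (e 1) = e 2) (h12 : T.bracket (e 1) (e 2) = e 0)
    (h20 : T.bracket (e 2) (e 0) = e 1) : So3Rel (φ (e 0)) (φ (e 1)) (φ (e 2)) where
  xy := by rw [← hφ, h01]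
  yz := by rw [← hφ, h12]
  zx := by rw [← hφ, h20]

/-- No faithful representation in dimension four for algebras whose radical is the sum of the
module `D_{1/2}` and a plane in the commutant on which `e 7` acts invertibly. -/
theorem false_of_DHalf (hφ : ∀ x y, φ (T.bracket x y) = φ x * φ y - φ y * φ x)
    (hinj : Function.Injective φ)
    (h01 : T.bracket (e 0) (e 1) = (2 : ℝ) • e 1) (h02 : T.bracket (e 0) (e 2) = (-2 : ℝ) • e 2)
    (h12 : T.bracket (e 1) (e 2) = e 0) (h03 : T.bracket (e 0) (e 3) = e 3)
    (hc : ∀ i ∈ ({5, 6, 7} : Finset (Fin 8)),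
      T.bracket (e 1) (e i) = 0 ∧ T.bracket (e 2) (e i) = 0)
    (h56 : T.bracket (e 5) (e 6) = 0) {s t u v : ℝ}
    (h75 : T.bracket (e 7) (e 5) = s • e 5 + t • e 6)
    (h76 : T.bracket (e 7) (e 6) = u • e 5 + v • e 6) (hdet : s * v - t * u ≠ 0) : False := by
  have hne : ∀ i, φ (e i) ≠ 0 := fun i h => e_ne_zero i (hinj (by rw [h, map_zero]))
  have comm : ∀ i ∈ ({5, 6, 7} : Finset (Fin 8)),
      φ (e 1) * φ (e i) = φ (e i) * φ (e 1) ∧ φ (e 2) * φ (e i) = φ (e i) * φ (e 2) := fun i hi =>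
    ⟨commute_of_bracket_eq_zero hφ (hc i hi).1, commute_of_bracket_eq_zero hφ (hc i hi).2⟩
  rcases (sl2Rel_of_table hφ h01 h02 h12).dependent (hne 0) (by rw [mul_eq hφ h03, one_smul])
    (hne 3) (comm 5 (by simp)) (comm 6 (by simp)) (comm 7 (by simp))
    (commute_of_bracket_eq_zero hφ h56) (by rw [← hφ, h75, map_add, map_smul, map_smul])
    (by rw [← hφ, h76, map_add, map_smul, map_smul]) hdet with h | ⟨r, h⟩
  · exact hne 5 h
  · have h1 := congrFun (hinj (h.trans (map_smul φ r (e 5)).symm)) 6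
    simp [e_apply] at h1

end Levi8

/-! ### The individual algebras -/

namespace Levi8

theorem mu_L8_1 (p : ℝ) (hp : p ≠ 0) : mu (L8_1 p).Alg = 5 := by
  -- Affine representation: the last column holds the translations `e 3, …, e 6`, and the upper left
  -- block is the action of the Levi factor and `e 7` on them.
  refine mu_eq_five ?_ (fun x => !![x 7, -x 2, x 1, 0, x 3; x 2, x 7, -x 0, 0, x 4;
    -x 1, x 0, x 7, 0, x 5; 0, 0, 0, p * x 7, x 6; 0, 0, 0, 0, 0]) ?_ ?_ ?_ ?_
  · intro φ hinj hφ
    have hne : ∀ i, φ (e i) ≠ 0 := fun i h => e_ne_zero i (hinj (by rw [h, map_zero]))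
    have comm : ∀ i j, (L8_1 p).table.bracket (e i) (e j) = 0 →
        φ (e i) * φ (e j) = φ (e j) * φ (e i) := fun i j h => commute_of_bracket_eq_zero hφ h
    have h23 : (L8_1 p).table.bracket (e 2) (e 3) = e 4 := by
      simp [Table.bracket, L8_1, so3, R3, e_apply]
    have h24 : (L8_1 p).table.bracket (e 2) (e 4) = -e 3 := by
      simp [Table.bracket, L8_1, so3, R3, e_apply]
    have h04 : (L8_1 p).table.bracket (e 0) (e 4) = e 5 := by
      simp [Table.bracket, L8_1, so3, R3, e_apply]
    have h13 : (L8_1 p).table.bracket (e 1) (e 3) = -e 5 := by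
      simp [Table.bracket, L8_1, so3, R3, e_apply]
    have h73 : (L8_1 p).table.bracket (e 7) (e 3) = e 3 := by
      simp [Table.bracket, L8_1, so3, R3, e_apply]
    have h74 : (L8_1 p).table.bracket (e 7) (e 4) = e 4 := by
      simp [Table.bracket, L8_1, so3, R3, e_apply]
    have h76 : (L8_1 p).table.bracket (e 7) (e 6) = p • e 6 := by
      simp [Table.bracket, L8_1, so3, R3, e_apply]
    have main : φ (e 3) = 0 ∨ φ (e 6) = 0 := by
      refine (so3Rel_of_table hφ ?_ ?_ ?_).eq_zero_of_R3 (hne 2) (A := φ (e 3)) (B := φ (e 4))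
        (C := φ (e 5)) (D := φ (e 6)) (S := φ (e 7)) (mul_eq hφ h23)
        (by rw [mul_eq hφ h24, map_neg, sub_eq_add_neg]) (comm 0 3 ?_) (mul_eq hφ h04)
        (by rw [mul_eq hφ h13, map_neg, sub_eq_add_neg]) (comm 1 4 ?_) (comm 3 5 ?_) (comm 4 5 ?_)
        ⟨comm 0 6 ?_, comm 0 7 ?_⟩ ⟨comm 1 6 ?_, comm 1 7 ?_⟩ ⟨comm 2 6 ?_, comm 2 7 ?_⟩
        (comm 3 6 ?_) (comm 4 6 ?_) (by rw [← hφ, h73]) (by rw [← hφ, h74]) hp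
        (by rw [← hφ, h76, map_smul])
      all_goals simp [Table.bracket, L8_1, so3, R3, e_apply]
    exact main.elim (hne 3) (hne 6)
  · intro x y
    rw [← Matrix.ext_iff]
    simp [Fin.forall_fin_succ]
    (repeat' apply And.intro) <;> ring
  · intro r x
    rw [← Matrix.ext_iff]
    simp [Fin.forall_fin_succ]
    ring
  · intro x y z hz
    simp [Table.bracket, L8_1, so3, R3, e_apply, Fin.forall_fin_succ] at hz
    rw [← Matrix.ext_iff]
    simp [Fin.forall_fin_succ, hz]
    (repeat' apply And.intro) <;> ring
  · intro x hx
    have h := fun i j => congrFun (congrFun hx i) j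
    simp [Fin.forall_fin_succ] at h ⊢
    grind

theorem mu_L8_3 : mu L8_3.Alg = 5 := by
  refine mu_eq_five ?_ (fun x => !![x 7, -x 1 / 2, -x 2 / 2, -x 0 / 2, x 3;
    x 1 / 2, x 7, -x 0 / 2, x 2 / 2, x 4; x 2 / 2, x 0 / 2, x 7, -x 1 / 2, x 5;
    x 0 / 2, -x 2 / 2, x 1 / 2, x 7, x 6; 0, 0, 0, 0, 0]) ?_ ?_ ?_ ?_
  · intro φ hinj hφ
    have hne : ∀ i, φ (e i) ≠ 0 := fun i h => e_ne_zero i (hinj (by rw [h, map_zero]))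
    have h23 : L8_3.table.bracket (e 2) (e 3) = (1 / 2 : ℝ) • e 5 := by
      simp [Table.bracket, L8_3, so3, R4, e_apply]
    have h25 : L8_3.table.bracket (e 2) (e 5) = (-1 / 2 : ℝ) • e 3 := by
      simp [Table.bracket, L8_3, so3, R4, e_apply]
    refine hne 3 ((so3Rel_of_table hφ ?_ ?_ ?_).eq_zero_of_R4 (hne 2)
      (by rw [mul_eq hφ h23, map_smul]) (by rw [mul_eq hφ h25, map_smul]; module))
    all_goals simp [Table.bracket, L8_3, so3, R4, e_apply]
  · intro x y
    rw [← Matrix.ext_iff]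
    simp [Fin.forall_fin_succ]
    (repeat' apply And.intro) <;> ring
  · intro r x
    rw [← Matrix.ext_iff]
    simp [Fin.forall_fin_succ]
    (repeat' apply And.intro) <;> ring
  · intro x y z hz
    simp [Table.bracket, L8_3, so3, R4, e_apply, Fin.forall_fin_succ] at hz
    rw [← Matrix.ext_iff]
    simp [Fin.forall_fin_succ, hz]
    (repeat' apply And.intro) <;> ring
  · intro x hx
    have h := fun i j => congrFun (congrFun hx i) j
    simp [Fin.forall_fin_succ] at h ⊢
    grind

theorem mu_L8_4 (p : ℝ) : mu (L8_4 p).Alg = 5 := by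
  refine mu_eq_five ?_ (fun x => !![p * x 7, -x 1 / 2, -x 2 / 2 + x 7, -x 0 / 2, x 3;
    x 1 / 2, p * x 7, -x 0 / 2, x 2 / 2 + x 7, x 4; x 2 / 2 - x 7, x 0 / 2, p * x 7, -x 1 / 2, x 5;
    x 0 / 2, -x 2 / 2 - x 7, x 1 / 2, p * x 7, x 6; 0, 0, 0, 0, 0]) ?_ ?_ ?_ ?_
  · intro φ hinj hφ
    have hne : ∀ i, φ (e i) ≠ 0 := fun i h => e_ne_zero i (hinj (by rw [h, map_zero]))
    have h23 : (L8_4 p).table.bracket (e 2) (e 3) = (1 / 2 : ℝ) • e 5 := by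
      simp [Table.bracket, L8_4, so3, R4, e_apply]
    have h25 : (L8_4 p).table.bracket (e 2) (e 5) = (-1 / 2 : ℝ) • e 3 := by
      simp [Table.bracket, L8_4, so3, R4, e_apply]
    refine hne 3 ((so3Rel_of_table hφ ?_ ?_ ?_).eq_zero_of_R4 (hne 2)
      (by rw [mul_eq hφ h23, map_smul]) (by rw [mul_eq hφ h25, map_smul]; module))
    all_goals simp [Table.bracket, L8_4, so3, R4, e_apply]
  · intro x y
    rw [← Matrix.ext_iff]
    simp [Fin.forall_fin_succ]
    (repeat' apply And.intro) <;> ring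
  · intro r x
    rw [← Matrix.ext_iff]
    simp [Fin.forall_fin_succ]
    (repeat' apply And.intro) <;> ring
  · intro x y z hz
    simp [Table.bracket, L8_4, so3, R4, e_apply, Fin.forall_fin_succ] at hz
    rw [← Matrix.ext_iff]
    simp [Fin.forall_fin_succ, hz]
    (repeat' apply And.intro) <;> ring
  · intro x hx
    have h := fun i j => congrFun (congrFun hx i) j
    simp [Fin.forall_fin_succ] at h ⊢
    grind

theorem mu_L8_7 (p q : ℝ) (hpq : p * q ≠ 0) : mu (L8_7 p q).Alg = 5 := by
  refine mu_eq_five ?_ (fun x => !![x 0 + x 7, x 1, 0, 0, x 3; x 2, -x 0 + x 7, 0, 0, x 4;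
    0, 0, p * x 7, 0, x 5; 0, 0, 0, q * x 7, x 6; 0, 0, 0, 0, 0]) ?_ ?_ ?_ ?_
  · intro φ hinj hφ
    have h75 : (L8_7 p q).table.bracket (e 7) (e 5) = p • e 5 := by
      simp [Table.bracket, L8_7, sl2, DHalf, e_apply]
    have h76 : (L8_7 p q).table.bracket (e 7) (e 6) = q • e 6 := by
      simp [Table.bracket, L8_7, sl2, DHalf, e_apply]
    refine false_of_DHalf (s := p) (t := 0) (u := 0) (v := q) hφ hinj ?_ ?_ ?_ ?_ ?_ ?_
      (by rw [h75]; module) (by rw [h76]; module) (by simpa using hpq)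
    all_goals simp [Table.bracket, L8_7, sl2, DHalf, e_apply]
  · intro x y
    rw [← Matrix.ext_iff]
    simp [Fin.forall_fin_succ]
    (repeat' apply And.intro) <;> ring
  · intro r x
    rw [← Matrix.ext_iff]
    simp [Fin.forall_fin_succ]
    (repeat' apply And.intro) <;> ring
  · intro x y z hz
    simp [Table.bracket, L8_7, sl2, DHalf, e_apply, Fin.forall_fin_succ] at hz
    rw [← Matrix.ext_iff]
    simp [Fin.forall_fin_succ, hz]
    (repeat' apply And.intro) <;> ring
  · intro x hx
    have h := fun i j => congrFun (congrFun hx i) j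
    simp [Fin.forall_fin_succ] at h ⊢
    grind

theorem mu_L8_8 (p : ℝ) : mu (L8_8 p).Alg = 5 := by
  refine mu_eq_five ?_ (fun x => !![x 0 + x 7, x 1, 0, 0, x 3; x 2, -x 0 + x 7, 0, 0, x 4;
    0, 0, p * x 7, x 7, x 5; 0, 0, 0, p * x 7, x 6; 0, 0, 0, 0, 0]) ?_ ?_ ?_ ?_
  · intro φ hinj hφ
    -- For `p = 0` the vector `e 7` acts nilpotently on the plane of `e 5` and `e 6`, so the
    -- invertible case does not apply.
    by_cases hp : p = 0
    · subst hp
      have hne : ∀ i, φ (e i) ≠ 0 := fun i h => e_ne_zero i (hinj (by rw [h, map_zero]))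
      have comm : ∀ i j, (L8_8 0).table.bracket (e i) (e j) = 0 →
          φ (e i) * φ (e j) = φ (e j) * φ (e i) := fun i j h => commute_of_bracket_eq_zero hφ h
      have h03 : (L8_8 0).table.bracket (e 0) (e 3) = e 3 := by
        simp [Table.bracket, L8_8, sl2, DHalf, e_apply]
      have h76 : (L8_8 0).table.bracket (e 7) (e 6) = e 5 := by
        simp [Table.bracket, L8_8, sl2, DHalf, e_apply]
      refine hne 5 ((sl2Rel_of_table hφ ?_ ?_ ?_).eq_zero_of_jordan (hne 0) (A := φ (e 3))
        (by rw [mul_eq hφ h03, one_smul]) (hne 3) ⟨comm 1 5 ?_, comm 2 5 ?_⟩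
        ⟨comm 1 6 ?_, comm 2 6 ?_⟩ ⟨comm 1 7 ?_, comm 2 7 ?_⟩ (comm 5 6 ?_) (comm 7 5 ?_)
        (by rw [← hφ, h76]))
      all_goals simp [Table.bracket, L8_8, sl2, DHalf, e_apply]
    · have h75 : (L8_8 p).table.bracket (e 7) (e 5) = p • e 5 := by
        simp [Table.bracket, L8_8, sl2, DHalf, e_apply]
      have h76 : (L8_8 p).table.bracket (e 7) (e 6) = e 5 + p • e 6 := by
        simp [Table.bracket, L8_8, sl2, DHalf, e_apply]
      refine false_of_DHalf (s := p) (t := 0) (u := 1) (v := p) hφ hinj ?_ ?_ ?_ ?_ ?_ ?_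
        (by rw [h75]; module) (by rw [h76]; module) (by simpa using hp)
      all_goals simp [Table.bracket, L8_8, sl2, DHalf, e_apply]
  · intro x y
    rw [← Matrix.ext_iff]
    simp [Fin.forall_fin_succ]
    (repeat' apply And.intro) <;> ring
  · intro r x
    rw [← Matrix.ext_iff]
    simp [Fin.forall_fin_succ]
    (repeat' apply And.intro) <;> ring
  · intro x y z hz
    simp [Table.bracket, L8_8, sl2, DHalf, e_apply, Fin.forall_fin_succ] at hz
    rw [← Matrix.ext_iff]
    simp [Fin.forall_fin_succ, hz]
    (repeat' apply And.intro) <;> ring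
  · intro x hx
    have h := fun i j => congrFun (congrFun hx i) j
    simp [Fin.forall_fin_succ] at h ⊢
    grind

theorem mu_L8_9 (p q : ℝ) (hq : q ≠ 0) : mu (L8_9 p q).Alg = 5 := by
  refine mu_eq_five ?_ (fun x => !![x 0 + x 7, x 1, 0, 0, x 3; x 2, -x 0 + x 7, 0, 0, x 4;
    0, 0, p * x 7, q * x 7, x 5; 0, 0, -(q * x 7), p * x 7, x 6; 0, 0, 0, 0, 0]) ?_ ?_ ?_ ?_
  · intro φ hinj hφ
    have h75 : (L8_9 p q).table.bracket (e 7) (e 5) = p • e 5 - q • e 6 := by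
      simp [Table.bracket, L8_9, sl2, DHalf, e_apply]
    have h76 : (L8_9 p q).table.bracket (e 7) (e 6) = q • e 5 + p • e 6 := by
      simp [Table.bracket, L8_9, sl2, DHalf, e_apply]
    -- The determinant is `p² + q²`, positive because `q ≠ 0`.
    refine false_of_DHalf (s := p) (t := -q) (u := q) (v := p) hφ hinj ?_ ?_ ?_ ?_ ?_ ?_
      (by rw [h75]; module) h76 (by nlinarith [sq_nonneg p, sq_pos_of_ne_zero hq])
    all_goals simp [Table.bracket, L8_9, sl2, DHalf, e_apply]
  · intro x y
    rw [← Matrix.ext_iff]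
    simp [Fin.forall_fin_succ]
    (repeat' apply And.intro) <;> ring
  · intro r x
    rw [← Matrix.ext_iff]
    simp [Fin.forall_fin_succ]
    (repeat' apply And.intro) <;> ring
  · intro x y z hz
    simp [Table.bracket, L8_9, sl2, DHalf, e_apply, Fin.forall_fin_succ] at hz
    rw [← Matrix.ext_iff]
    simp [Fin.forall_fin_succ, hz]
    (repeat' apply And.intro) <;> ring
  · intro x hx
    have h := fun i j => congrFun (congrFun hx i) j
    simp [Fin.forall_fin_succ] at h ⊢
    grind

theorem mu_L8_10 (p : ℝ) (hp : p ≠ 0) : mu (L8_10 p).Alg = 5 := by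
  -- Rows and columns 0 to 3 carry the symplectic representation of the Heisenberg algebra, in which
  -- the bracket of `e 3` and `e 4` is twice a matrix unit; hence the entry `2 * x 5`. The last row
  -- carries `e 6`.
  refine mu_eq_five ?_ (fun x => !![2 * x 7, -x 4, x 3, 2 * x 5, 0; 0, x 0 + x 7, x 1, x 3, 0;
    0, x 2, -x 0 + x 7, x 4, 0; 0, 0, 0, 0, 0; 0, 0, 0, x 6, p * x 7]) ?_ ?_ ?_ ?_
  · intro φ hinj hφ
    have h75 : (L8_10 p).table.bracket (e 7) (e 5) = (2 : ℝ) • e 5 := by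
      simp [Table.bracket, L8_10, sl2, DHalf, e_apply]
    have h76 : (L8_10 p).table.bracket (e 7) (e 6) = p • e 6 := by
      simp [Table.bracket, L8_10, sl2, DHalf, e_apply]
    refine false_of_DHalf (s := 2) (t := 0) (u := 0) (v := p) hφ hinj ?_ ?_ ?_ ?_ ?_ ?_
      (by rw [h75]; module) (by rw [h76]; module) (by simpa using hp)
    all_goals simp [Table.bracket, L8_10, sl2, DHalf, e_apply]
  · intro x y
    rw [← Matrix.ext_iff]
    simp [Fin.forall_fin_succ]
    (repeat' apply And.intro) <;> ring
  · intro r x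
    rw [← Matrix.ext_iff]
    simp [Fin.forall_fin_succ]
    (repeat' apply And.intro) <;> ring
  · intro x y z hz
    simp [Table.bracket, L8_10, sl2, DHalf, e_apply, Fin.forall_fin_succ] at hz
    rw [← Matrix.ext_iff]
    simp [Fin.forall_fin_succ, hz]
    (repeat' apply And.intro) <;> ring
  · intro x hx
    have h := fun i j => congrFun (congrFun hx i) j
    simp [Fin.forall_fin_succ] at h ⊢
    grind

theorem mu_L8_11 : mu L8_11.Alg = 5 := by
  -- The additional corner entry `2 * x 7` multiplies the entry `x 6` and produces the summand `e 5`
  -- in the bracket of `e 7` with `e 6`.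
  refine mu_eq_five ?_ (fun x => !![2 * x 7, -x 4, x 3, 2 * x 5, 2 * x 7; 0, x 0 + x 7, x 1, x 3, 0;
    0, x 2, -x 0 + x 7, x 4, 0; 0, 0, 0, 0, 0; 0, 0, 0, x 6, 2 * x 7]) ?_ ?_ ?_ ?_
  · intro φ hinj hφ
    have h75 : L8_11.table.bracket (e 7) (e 5) = (2 : ℝ) • e 5 := by
      simp [Table.bracket, L8_11, sl2, DHalf, e_apply]
    have h76 : L8_11.table.bracket (e 7) (e 6) = e 5 + (2 : ℝ) • e 6 := by
      simp [Table.bracket, L8_11, sl2, DHalf, e_apply]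
    refine false_of_DHalf (s := 2) (t := 0) (u := 1) (v := 2) hφ hinj ?_ ?_ ?_ ?_ ?_ ?_
      (by rw [h75]; module) (by rw [h76]; module) (by norm_num)
    all_goals simp [Table.bracket, L8_11, sl2, DHalf, e_apply]
  · intro x y
    rw [← Matrix.ext_iff]
    simp [Fin.forall_fin_succ]
    (repeat' apply And.intro) <;> ring
  · intro r x
    rw [← Matrix.ext_iff]
    simp [Fin.forall_fin_succ]
    (repeat' apply And.intro) <;> ring
  · intro x y z hz
    simp [Table.bracket, L8_11, sl2, DHalf, e_apply, Fin.forall_fin_succ] at hz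
    rw [← Matrix.ext_iff]
    simp [Fin.forall_fin_succ, hz]
    (repeat' apply And.intro) <;> ring
  · intro x hx
    have h := fun i j => congrFun (congrFun hx i) j
    simp [Fin.forall_fin_succ] at h ⊢
    grind

theorem mu_L8_12 (p : ℝ) (hp : p ≠ 0) (hp1 : p ≠ 1) : mu (L8_12 p).Alg = 5 := by
  refine mu_eq_five ?_ (fun x => !![2 * x 0 + x 7, 2 * x 1, 0, 0, x 3; x 2, x 7, x 1, 0, x 4;
    0, 2 * x 2, -2 * x 0 + x 7, 0, x 5; 0, 0, 0, p * x 7, x 6; 0, 0, 0, 0, 0]) ?_ ?_ ?_ ?_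
  · intro φ hinj hφ
    have hne : ∀ i, φ (e i) ≠ 0 := fun i h => e_ne_zero i (hinj (by rw [h, map_zero]))
    have comm : ∀ i j, (L8_12 p).table.bracket (e i) (e j) = 0 →
        φ (e i) * φ (e j) = φ (e j) * φ (e i) := fun i j h => commute_of_bracket_eq_zero hφ h
    have h03 : (L8_12 p).table.bracket (e 0) (e 3) = (2 : ℝ) • e 3 := by
      simp [Table.bracket, L8_12, sl2, D1, e_apply]
    have h23 : (L8_12 p).table.bracket (e 2) (e 3) = e 4 := by
      simp [Table.bracket, L8_12, sl2, D1, e_apply]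
    have h73 : (L8_12 p).table.bracket (e 7) (e 3) = e 3 := by
      simp [Table.bracket, L8_12, sl2, D1, e_apply]
    have h76 : (L8_12 p).table.bracket (e 7) (e 6) = p • e 6 := by
      simp [Table.bracket, L8_12, sl2, D1, e_apply]
    have h23' : φ (e 2) * φ (e 3) - φ (e 3) * φ (e 2) = φ (e 4) := by rw [← hφ, h23]
    have h34 := comm 3 4 (by simp [Table.bracket, L8_12, sl2, D1, e_apply])
    have main : φ (e 3) = 0 ∨ φ (e 6) = 0 ∨
        φ (e 1) * φ (e 1) = 0 ∧ φ (e 6) * φ (e 6) = 0 ∧ p = 1 := by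
      refine (sl2Rel_of_table hφ ?_ ?_ ?_).weight_two_or (hne 0) (A := φ (e 3)) (X := φ (e 6))
        (Z := φ (e 7)) (by rw [mul_eq hφ h03, map_smul]) (by rw [h23', h34])
        (comm 0 6 ?_) ⟨comm 1 6 ?_, comm 2 6 ?_⟩ (comm 0 7 ?_) ⟨comm 1 7 ?_, comm 2 7 ?_⟩ hp
        (by rw [← hφ, h76, map_smul]) (by rw [← hφ, h73]) (comm 3 6 ?_)
      all_goals simp [Table.bracket, L8_12, sl2, D1, e_apply]
    rcases main with h | h | ⟨-, -, h⟩
    · exact hne 3 h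
    · exact hne 6 h
    · exact hp1 h
  · intro x y
    rw [← Matrix.ext_iff]
    simp [Fin.forall_fin_succ]
    (repeat' apply And.intro) <;> ring
  · intro r x
    rw [← Matrix.ext_iff]
    simp [Fin.forall_fin_succ]
    (repeat' apply And.intro) <;> ring
  · intro x y z hz
    simp [Table.bracket, L8_12, sl2, D1, e_apply, Fin.forall_fin_succ] at hz
    rw [← Matrix.ext_iff]
    simp [Fin.forall_fin_succ, hz]
    (repeat' apply And.intro) <;> ring
  · intro x hx
    have h := fun i j => congrFun (congrFun hx i) j
    simp [Fin.forall_fin_succ] at h ⊢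
    grind

theorem mu_L8_20 : mu L8_20.Alg = 5 := by
  refine mu_eq_five ?_ (fun x => !![3 * x 0 + x 7, 3 * x 1, 0, 0, x 3; x 2, x 0 + x 7, 2 * x 1, 0, x 4;
    0, 2 * x 2, -x 0 + x 7, x 1, x 5; 0, 0, 3 * x 2, -3 * x 0 + x 7, x 6; 0, 0, 0, 0, 0]) ?_ ?_ ?_ ?_
  · intro φ hinj hφ
    have hne : ∀ i, φ (e i) ≠ 0 := fun i h => e_ne_zero i (hinj (by rw [h, map_zero]))
    have h03 : L8_20.table.bracket (e 0) (e 3) = (3 : ℝ) • e 3 := by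
      simp [Table.bracket, L8_20, sl2, D3Half, e_apply]
    refine hne 3 ((sl2Rel_of_table hφ ?_ ?_ ?_).eq_zero_of_weight_three (hne 0)
      (by rw [mul_eq hφ h03, map_smul]))
    all_goals simp [Table.bracket, L8_20, sl2, D3Half, e_apply]
  · intro x y
    rw [← Matrix.ext_iff]
    simp [Fin.forall_fin_succ]
    (repeat' apply And.intro) <;> ring
  · intro r x
    rw [← Matrix.ext_iff]
    simp [Fin.forall_fin_succ]
    (repeat' apply And.intro) <;> ring
  · intro x y z hz
    simp [Table.bracket, L8_20, sl2, D3Half, e_apply, Fin.forall_fin_succ] at hz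
    rw [← Matrix.ext_iff]
    simp [Fin.forall_fin_succ, hz]
    (repeat' apply And.intro) <;> ring
  · intro x hx
    have h := fun i j => congrFun (congrFun hx i) j
    simp [Fin.forall_fin_succ] at h ⊢
    grind

theorem mu_L8_22 : mu L8_22.Alg = 5 := by
  -- The space is two standard modules plus a trivial one. `D_1` consists of the traceless maps from
  -- the second standard module to the first, and `D_{1/2}` of the maps from the trivial module to
  -- the first; all their products vanish.
  refine mu_eq_five ?_ (fun x => !![x 0, x 1, -x 4, x 3, x 6; x 2, -x 0, -x 5, x 4, x 7;
    0, 0, x 0, x 1, 0; 0, 0, x 2, -x 0, 0; 0, 0, 0, 0, 0]) ?_ ?_ ?_ ?_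
  · intro φ hinj hφ
    have hne : ∀ i, φ (e i) ≠ 0 := fun i h => e_ne_zero i (hinj (by rw [h, map_zero]))
    have comm : ∀ i j, L8_22.table.bracket (e i) (e j) = 0 →
        φ (e i) * φ (e j) = φ (e j) * φ (e i) := fun i j h => commute_of_bracket_eq_zero hφ h
    have h03 : L8_22.table.bracket (e 0) (e 3) = (2 : ℝ) • e 3 := by
      simp [Table.bracket, L8_22, sl2, D1, DHalf, e_apply]
    have h06 : L8_22.table.bracket (e 0) (e 6) = e 6 := by
      simp [Table.bracket, L8_22, sl2, D1, DHalf, e_apply]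
    have h23 : L8_22.table.bracket (e 2) (e 3) = e 4 := by
      simp [Table.bracket, L8_22, sl2, D1, DHalf, e_apply]
    have h23' : φ (e 2) * φ (e 3) - φ (e 3) * φ (e 2) = φ (e 4) := by rw [← hφ, h23]
    have h34 := comm 3 4 (by simp [Table.bracket, L8_22, sl2, D1, DHalf, e_apply])
    refine hne 3 ((sl2Rel_of_table hφ ?_ ?_ ?_).eq_zero_of_weight_two (hne 0) (X := φ (e 6))
      (by rw [mul_eq hφ h06, one_smul]) (hne 6) (by rw [mul_eq hφ h03, map_smul])
      (by rw [h23', h34]))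
    all_goals simp [Table.bracket, L8_22, sl2, D1, DHalf, e_apply]
  · intro x y
    rw [← Matrix.ext_iff]
    simp [Fin.forall_fin_succ]
    (repeat' apply And.intro) <;> ring
  · intro r x
    rw [← Matrix.ext_iff]
    simp [Fin.forall_fin_succ]
  · intro x y z hz
    simp [Table.bracket, L8_22, sl2, D1, DHalf, e_apply, Fin.forall_fin_succ] at hz
    rw [← Matrix.ext_iff]
    simp [Fin.forall_fin_succ, hz]
    (repeat' apply And.intro) <;> ring
  · intro x hx
    have h := fun i j => congrFun (congrFun hx i) j
    simp [Fin.forall_fin_succ] at h ⊢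
    grind

end Levi8

theorem mainTheorem6 :
    (∀ p : ℝ, p ≠ 0 → mu (Levi8.L8_1 p).Alg = 5) ∧
    mu Levi8.L8_3.Alg = 5 ∧
    (∀ p : ℝ, mu (Levi8.L8_4 p).Alg = 5) ∧
    (∀ p q : ℝ, p * q ≠ 0 → mu (Levi8.L8_7 p q).Alg = 5) ∧
    (∀ p : ℝ, mu (Levi8.L8_8 p).Alg = 5) ∧
    (∀ p q : ℝ, q ≠ 0 → mu (Levi8.L8_9 p q).Alg = 5) ∧
    (∀ p : ℝ, p ≠ 0 → mu (Levi8.L8_10 p).Alg = 5) ∧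
    mu Levi8.L8_11.Alg = 5 ∧
    (∀ p : ℝ, p ≠ 0 → p ≠ 1 → mu (Levi8.L8_12 p).Alg = 5) ∧
    mu Levi8.L8_20.Alg = 5 ∧
    mu Levi8.L8_22.Alg = 5 :=
  ⟨Levi8.mu_L8_1, Levi8.mu_L8_3, Levi8.mu_L8_4, Levi8.mu_L8_7, Levi8.mu_L8_8, Levi8.mu_L8_9,
    Levi8.mu_L8_10, Levi8.mu_L8_11, Levi8.mu_L8_12, Levi8.mu_L8_20, Levi8.mu_L8_22⟩
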